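/- Notation. For $\mathbf k\in\mathbb Z^d$ let $|\mathbf k|=\max_v|k_v|$ and $\langle\mathbf k\rangle=\max\{1,|\mathbf k|\}$; for $\vec\omega\in\mathbb R^d$ let $\mathbf i\cdot\vec\omega=\sum_v i_v\omega_v$. A translation invariant Banach algebra of functions $(\mathfrak F,\|\cdot\|_{\mathfrak F})$ is a unital algebra of functions $\mathbb C\to\mathbb C$ (pointwise operations), complete for a submultiplicative norm with $\|1\|_{\mathfrak F}=1$, such that $f(\cdot-t)\in\mathfrak F$ and $\|f(\cdot-t)\|_{\mathfrak F}=\|f\|_{\mathfrak F}$ for all $f\in\mathfrak F$, $t\in\mathbb R$. For functions $f,f'$ that need not lie in $\mathfrak F$, a bound on $\|f'-f\|_{\mathfrak F}$ includes the statement $f'-f\in\mathfrak F$. For $\phi\in\mathbb R^{\mathbb Z^d}$ let $(T_\phi u)_{\mathbf i}=\sum_{\mathbf j}\phi_{\mathbf i-\mathbf j}u_{\mathbf j}$ on $\ell^2(\mathbb Z^d)$, and $\|T_\phi\|_r=\big(\sum_{\mathbf k}|\phi_{\mathbf k}|^2\langle\mathbf k\rangle^{2r}\big)^{1/2}$. The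 operator $T_\phi+f(\mathbf i\cdot\vec\omega)\delta_{\mathbf i\mathbf i'}$ acts on $\ell^2(\mathbb Z^d)$; the possibly unbounded multiplication operator has its natural domain. An operator has pure point spectrum if it has a complete set of eigenfunctions, i.e. one whose linear span is dense in $\ell^2(\mathbb Z^d)$. Theorem. Let $\alpha_0>d/2$, $\tau>0$, $\delta>0$, $s>\alpha_0+\tau+d/2+12\delta$, and put $q=s-d/2-5\delta-\alpha_0$. There is $C=C(d,s,\delta,\tau,\alpha_0)>0$ such that the following holds for every $\gamma>0$. (a) There is $\epsilon_0=\epsilon_0(s,d,\delta,\tau,\gamma,\alpha_0)>0$ with the following property. Let $\phi_{\mathbf 0}=0$, $|\phi_{\mathbf i}|\le|\mathbf i|^{-s}$ for $\mathbf i\ne\mathbf 0$, and $\|T_\phi\|_{s-d/2-\delta}\le\epsilon_0$. Let $\mathfrak F$ be a translation invariant Banach algebra of functions, $\vec\omega\in\mathbb R^d$, and let $f:\mathbb C\to\mathbb C$ be any function such that for all $\mathbf i\in\mathbb Z^d\setminus\{\mathbf 0\}$ the function $x\mapsto f(x)-f(x-\mathbf i\cdot\vec\omega)$ has no zeros and $$\big(f-f(\cdot-\mathbf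 i\cdot\vec\omega)\big)^{-1}\in\mathfrak F,\qquad \big\|\big(f-f(\cdot-\mathbf i\cdot\vec\omega)\big)^{-1}\big\|_{\mathfrak F}\le\gamma^{-1}|\mathbf i|^{\tau}.\tag{DC}$$ Then there is a function $f'$ with $$\|f'-f\|_{\mathfrak F}\le C\|T_\phi\|_{s-d/2-\delta},\qquad\text{and, if } q>\tfrac12,\quad \|f'-f\|_{\mathfrak F}\le C\|T_\phi\|_{s-d/2-\delta}^{1/q},$$ such that $H'=T_\phi+f'(\mathbf i\cdot\vec\omega)\delta_{\mathbf i\mathbf i'}$ has pure point spectrum with a complete set of eigenfunctions $\{e_{\mathbf k}\}_{\mathbf k\in\mathbb Z^d}$ satisfying $$|(e_{\mathbf k})_{\mathbf i}|\le 2\langle\mathbf i-\mathbf k\rangle^{-s+\tau+d/2+12\delta}\qquad(\mathbf i,\mathbf k\in\mathbb Z^d).$$ If moreover $f$ is real-valued, the spectrum of $H'$ is the closure of $\{f(\mathbf i\cdot\vec\omega):\mathbf i\in\mathbb Z^d\}$ in $\mathbb R$. (b) For every $\eta>0$ there is $\epsilon_0=\epsilon_0(\eta,s,d,\delta,\tau,\gamma,\alpha_0)>0$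 with the following property. Let $\phi,\mathfrak F,\vec\omega$ be as in (a), with this $\epsilon_0$, and let $f:\mathbb C\to\mathbb C$ be such that (DC) holds for every function $g$ with $\|g-f\|_{\mathfrak F}\le\eta$ in place of $f$. Then there is a function $f'$ satisfying the same bounds on $\|f'-f\|_{\mathfrak F}$ as in (a) such that $H=T_\phi+f(\mathbf i\cdot\vec\omega)\delta_{\mathbf i\mathbf i'}$ has pure point spectrum with a complete set of eigenfunctions $\{e_{\mathbf k}\}$ satisfying the same decay estimate. If moreover $f$ is real-valued, then all $f'(\mathbf i\cdot\vec\omega)$ are real and the spectrum of $H$ is the closure of $\{f'(\mathbf i\cdot\vec\omega):\mathbf i\in\mathbb Z^d\}$ in $\mathbb R$. -/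

import Mathlib

noncomputable section

namespace PowerLaw

/-- The lattice `ℤ^d`; its norm `‖·‖` in Mathlib is the sup norm `max_v |k_v|`. -/
abbrev Lattice (d : ℕ) : Type := Fin d → ℤ

/-- The Hilbert space `ℓ²(ℤ^d)` of complex sequences. -/
abbrev Ell2 (d : ℕ) : Type := lp (fun _ : Lattice d => ℂ) 2

/-- `⟨k⟩ = max {1, |k|}`. -/
def bracket {d : ℕ} (k : Lattice d) : ℝ := max 1 ‖k‖

/-- `i · ω = ∑ v, i_v ω_v`. -/
def dot {d : ℕ} (i : Lattice d) (ω : Fin d → ℝ) : ℝ := ∑ v, (i v : ℝ) * ω v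

/-! ### Translation invariant Banach algebras of functions -/

/-- A translation invariant Banach algebra of functions on `ℂ`: a unital algebra of functions
`ℂ → ℂ` under the pointwise operations, complete for an algebra norm with `‖1‖ = 1`, and
invariant, together with its norm, under the translations `f ↦ f (· - t)`, `t` real. -/
structure FunctionBanachAlgebra where
  carrier : Subalgebra ℂ (ℂ → ℂ)
  nrm : AlgebraNorm ℂ carrier
  nrm_one : nrm 1 = 1
  complete : ∀ u : ℕ → carrier,
    (∀ ε : ℝ, 0 < ε → ∃ N, ∀ m, N ≤ m → ∀ n, N ≤ n → nrm (u m - u n) < ε) →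
    ∃ a : carrier, ∀ ε : ℝ, 0 < ε → ∃ N, ∀ n, N ≤ n → nrm (u n - a) < ε
  translate_mem : ∀ (t : ℝ) (g : carrier), (fun x : ℂ => (g : ℂ → ℂ) (x - (t : ℂ))) ∈ carrier
  nrm_translate : ∀ (t : ℝ) (g : carrier), nrm ⟨_, translate_mem t g⟩ = nrm g

/-- `‖g - f‖ ≤ r` in the norm of the function algebra; this includes that `g - f` belongs to the
algebra, while `f` and `g` themselves need not. -/
def FunctionBanachAlgebra.DistLE (F : FunctionBanachAlgebra) (g f : ℂ → ℂ) (r : ℝ) : Prop :=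
  ∃ h : F.carrier, (h : ℂ → ℂ) = g - f ∧ F.nrm h ≤ r

/-- The non-resonance condition: for all `k ≠ 0` the function
`x ↦ f x - f (x - k · ω)` vanishes nowhere and its pointwise inverse `g` belongs to the algebra,
with `‖g‖ ≤ γ⁻¹ |k|^τ`. -/
def IsDistal {d : ℕ} (F : FunctionBanachAlgebra) (ω : Fin d → ℝ) (τ γ : ℝ) (f : ℂ → ℂ) : Prop :=
  ∀ k : Lattice d, k ≠ 0 → ∃ g : F.carrier,
    (∀ x : ℂ, (f x - f (x - (dot k ω : ℂ))) * (g : ℂ → ℂ) x = 1) ∧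
    F.nrm g ≤ γ⁻¹ * ‖k‖ ^ τ

/-! ### The operators -/

/-- The symbol of a polynomial long-range hopping: `φ_0 = 0` and `|φ_i| ≤ |i|^{-s}` for
`i ≠ 0`. -/
def IsPolyHopping {d : ℕ} (φ : Lattice d → ℝ) (s : ℝ) : Prop :=
  φ 0 = 0 ∧ ∀ i : Lattice d, i ≠ 0 → |φ i| ≤ ‖i‖ ^ (-s)

/-- The Sobolev norm `‖T_φ‖_r = (∑_k ‖(T_φ)_k‖² ⟨k⟩^{2r})^{1/2}`. The `k`-th diagonal of `T_φ` is
the constant `φ_k`, whose norm is `|φ_k|` in every algebra with `‖1‖ = 1`. -/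
def sobolevNorm {d : ℕ} (φ : Lattice d → ℝ) (r : ℝ) : ℝ :=
  Real.sqrt (∑' k : Lattice d, |φ k| ^ 2 * bracket k ^ (2 * r))

/-- The operator `(T_φ u)_i = ∑_j φ_{i-j} u_j` on its natural domain in `ℓ²(ℤ^d)` (which is all of
`ℓ²(ℤ^d)` as soon as `φ` is summable). -/
def hopping {d : ℕ} (φ : Lattice d → ℝ) : Ell2 d →ₗ.[ℂ] Ell2 d where
  domain :=
    { carrier := {u | (∀ i, Summable fun j => (φ (i - j) : ℂ) * u j) ∧
        Memℓp (fun i => ∑' j, (φ (i - j) : ℂ) * u j) 2}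
      add_mem' := by
        rintro u v ⟨hu, hu'⟩ ⟨hv, hv'⟩
        have h : ∀ i j, (φ (i - j) : ℂ) * (u + v) j = φ (i - j) * u j + φ (i - j) * v j := by
          intro i j
          rw [lp.coeFn_add, Pi.add_apply, mul_add]
        refine ⟨fun i => ?_, ?_⟩
        · simp only [h]
          exact (hu i).add (hv i)
        · simp only [h]
          convert hu'.add hv' using 1
          funext i
          exact (hu i).tsum_add (hv i)
      zero_mem' := by
        refine ⟨fun i => ?_, ?_⟩
        · simp
        · have h : (fun i : Lattice d => ∑' j, (φ (i - j) : ℂ) * (0 : Ell2 d) j) = 0 := by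
            funext i
            simp
          rw [h]
          exact zero_memℓp
      smul_mem' := by
        rintro c u ⟨hu, hu'⟩
        have h : ∀ i j, (φ (i - j) : ℂ) * (c • u) j = c * (φ (i - j) * u j) := by
          intro i j
          rw [lp.coeFn_smul, Pi.smul_apply, smul_eq_mul]
          ring
        refine ⟨fun i => ?_, ?_⟩
        · simp only [h]
          exact (hu i).mul_left c
        · simp only [h, tsum_mul_left]
          exact hu'.const_smul c }
  toFun :=
    { toFun := fun u => ⟨fun i => ∑' j, (φ (i - j) : ℂ) * (u : Ell2 d) j, u.2.2⟩
      map_add' := by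
        intro u v
        apply Subtype.ext
        funext i
        have h : ∀ j, (φ (i - j) : ℂ) * ((u + v : _) : Ell2 d) j
            = φ (i - j) * (u : Ell2 d) j + φ (i - j) * (v : Ell2 d) j := by
          intro j
          rw [Submodule.coe_add, lp.coeFn_add, Pi.add_apply, mul_add]
        rw [lp.coeFn_add, Pi.add_apply]
        simp only [h]
        exact (u.2.1 i).tsum_add (v.2.1 i)
      map_smul' := by
        intro c u
        apply Subtype.ext
        funext i
        have h : ∀ j, (φ (i - j) : ℂ) * ((c • u : _) : Ell2 d) j
            = c * (φ (i - j) * (u : Ell2 d) j) := by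
          intro j
          rw [Submodule.coe_smul, lp.coeFn_smul, Pi.smul_apply, smul_eq_mul]
          ring
        rw [lp.coeFn_smul, Pi.smul_apply]
        simp only [h, tsum_mul_left]
        rfl }

/-- Multiplication by the (possibly unbounded) sequence `a`, on the natural domain
`{u ∈ ℓ² : a u ∈ ℓ²}`. -/
def potential {d : ℕ} (a : Lattice d → ℂ) : Ell2 d →ₗ.[ℂ] Ell2 d where
  domain :=
    { carrier := {u | Memℓp (fun i => a i * u i) 2}
      add_mem' := by
        intro u v hu hv
        have h : (fun i => a i * (u + v) i) = (fun i => a i * u i) + fun i => a i * v i := by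
          funext i
          rw [lp.coeFn_add, Pi.add_apply, Pi.add_apply, mul_add]
        simp only [Set.mem_ofPred_eq, h]
        exact Memℓp.add hu hv
      zero_mem' := by
        have h : (fun i => a i * (0 : Ell2 d) i) = 0 := by
          funext i
          simp
        rw [Set.mem_ofPred_eq, h]
        exact zero_memℓp
      smul_mem' := by
        intro c u hu
        have h : (fun i => a i * (c • u) i) = c • fun i => a i * u i := by
          funext i
          rw [lp.coeFn_smul, Pi.smul_apply, Pi.smul_apply, smul_eq_mul, smul_eq_mul]
          ring
        simp only [Set.mem_ofPred_eq, h]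
        exact Memℓp.const_smul hu c }
  toFun :=
    { toFun := fun u => ⟨fun i => a i * (u : Ell2 d) i, u.2⟩
      map_add' := by
        intro u v
        apply Subtype.ext
        funext i
        exact mul_add _ _ _
      map_smul' := by
        intro c u
        apply Subtype.ext
        funext i
        exact mul_left_comm _ _ _ }

/-- The quasi-periodic operator `T_φ + f(i · ω) δ_{ii'}` on `ℓ²(ℤ^d)`, with domain the
intersection of the domains of the two summands. -/
def hamiltonian {d : ℕ} (φ : Lattice d → ℝ) (f : ℂ → ℂ) (ω : Fin d → ℝ) :
    Ell2 d →ₗ.[ℂ] Ell2 d :=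
  hopping φ + potential fun i => f (dot i ω : ℂ)

/-! ### Spectral notions for unbounded operators -/

/-- The resolvent set consists of the `z` for which `A - z` has a bounded everywhere defined
two-sided inverse `R`; the spectrum is its complement. -/
def opSpectrum {E : Type*} [NormedAddCommGroup E] [NormedSpace ℂ E] (A : E →ₗ.[ℂ] E) : Set ℂ :=
  {z | ¬ ∃ R : E →L[ℂ] E,
    (∀ w : E, ∃ h : R w ∈ A.domain, A ⟨R w, h⟩ - z • R w = w) ∧
    ∀ u : A.domain, R (A u - z • (u : E)) = u}

/-- `e` is an eigenfunction of `A`: a non-zero element of the domain with `A e = c e`. -/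
def IsEigenfunction {E : Type*} [NormedAddCommGroup E] [NormedSpace ℂ E] (A : E →ₗ.[ℂ] E)
    (e : E) : Prop :=
  e ≠ 0 ∧ ∃ (c : ℂ) (h : e ∈ A.domain), A ⟨e, h⟩ = c • e

/-- A set of vectors is complete if its closed linear span is the whole space. -/
def IsCompleteSystem {E : Type*} [NormedAddCommGroup E] [NormedSpace ℂ E] (S : Set E) : Prop :=
  (Submodule.span ℂ S).topologicalClosure = ⊤

/-- A (not necessarily normal) operator has pure point spectrum if its eigenfunctions form a
complete set. -/
def HasPurePointSpectrum {E : Type*} [NormedAddCommGroup E] [NormedSpace ℂ E]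
    (A : E →ₗ.[ℂ] E) : Prop :=
  IsCompleteSystem {e : E | IsEigenfunction A e}

/-- Power-law localization with rate `ρ`: pure point spectrum, with a complete set of
eigenfunctions `(e_k)` such that `|(e_k)_i| ≤ 2 ⟨i - k⟩^{-ρ}`. -/
def IsPowerLawLocalized {d : ℕ} (A : Ell2 d →ₗ.[ℂ] Ell2 d) (ρ : ℝ) : Prop :=
  HasPurePointSpectrum A ∧
  ∃ e : Lattice d → Ell2 d,
    (∀ k, IsEigenfunction A (e k)) ∧
    IsCompleteSystem (Set.range e) ∧
    ∀ i k : Lattice d, ‖e k i‖ ≤ 2 * bracket (i - k) ^ (-ρ)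

/-- Size of the correction of the potential in terms of `N = ‖T_φ‖`: it is at most `C N`, and at
most `C N^{1/q}` provided that `q > 1/2`. -/
def SmallCorrection (F : FunctionBanachAlgebra) (f' f : ℂ → ℂ) (C N q : ℝ) : Prop :=
  F.DistLE f' f (C * N) ∧ (1 / 2 < q → F.DistLE f' f (C * N ^ (1 / q)))

end PowerLaw

end

/-! Everything reduces to an invertible matrix Q with (T_φ + f_L) Q = Q f_R, where f_L = f - a u and
f_R = f + (1 - a) u for an unknown function u. For a = 1 the diagonal form f_R = f is prescribed and
the potential becomes f' = f - u; for a = 0 the potential f is kept and f' = f + u supplies the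
eigenvalues. The columns of Q are the eigenfunctions. Q is sought in the Banach algebra `Crossed` of
matrices x_{i-j}(i·ω); as f is arbitrary and possibly unbounded, the equation is imposed coefficient
by coefficient (`Comm`).

Q is the limit of a KAM iteration over dyadic scales. Stage n uses the weighted ℓ² norm with weight
K⟨k⟩^α e^{|k|/2^n}, which is submultiplicative for α > d/2 (`bd_mul`). Let N be the Sobolev norm of
order R of φ and r = 2^{-(R-α)}. Adding the shell 2^n ≤ ⟨k⟩ < 2^{n+1} of φ creates an error O(N
r^n). In `kam_step` the diagonal of the error goes into u, and the rest is removed by solving [f_R,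
X] = Y (`exists_comm_eq`), where halving the exponential rate pays for the small divisors with a
factor 2^{τn}. So the errors are O(N r^n) and the corrections of Q are O(N (2^τ r)^n), summable
because τ < R - α. Using the exponential weights of the individual stages improves the decay of the
coefficients of Q - 1 to ⟨k⟩^{-(α+m)} when α + τ + m < R (`exists_conjugation`). The non-resonance
condition is needed for f_R only, which is f itself for a = 1 and stays within η of f for a = 0.

Since φ_0 = 0, the diagonal coefficient of the equation reads u Q_0 = (T_φ (Q - 1))_0. Thus u is
quadratic in N, hence below both N and N^{1/q} (for 1/q < 2) once N is small. Finally Q and its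
inverse act boundedly on ℓ² and intertwine the operator with multiplication by f_R on natural
domains (`Diagonalizes`), which gives completeness and the spectrum. -/

noncomputable section

open Filter Topology

namespace PowerLaw

/-! ### Function algebras as Banach algebras with characters and translations -/

namespace FunctionBanachAlgebra

/-- The Banach algebra underlying a translation invariant Banach algebra of functions. -/
def Alg (F : FunctionBanachAlgebra) : Type := F.carrier

variable {F : FunctionBanachAlgebra}

instance : CommRing F.Alg := inferInstanceAs (CommRing F.carrier)

instance : Algebra ℂ F.Alg := inferInstanceAs (Algebra ℂ F.carrier)

instance : NormedCommRing F.Alg :=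
  { (inferInstance : CommRing F.Alg), F.nrm.toRingNorm.toNormedRing with }

instance : NormedAlgebra ℂ F.Alg where
  norm_smul_le c g := (F.nrm.smul' c g).le

instance : NormOneClass F.Alg := ⟨F.nrm_one⟩

instance : CompleteSpace F.Alg := by
  refine Metric.complete_of_cauchySeq_tendsto fun u hu => ?_
  obtain ⟨a, ha⟩ := F.complete u fun ε hε => by
    obtain ⟨N, hN⟩ := Metric.cauchySeq_iff.1 hu ε hε
    exact ⟨N, fun m hm n hn => (dist_eq_norm (u m) (u n)).symm.trans_lt (hN m hm n hn)⟩
  refine ⟨(a : F.Alg), Metric.tendsto_atTop.2 fun ε hε => ?_⟩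
  obtain ⟨N, hN⟩ := ha ε hε
  exact ⟨N, fun n hn => (dist_eq_norm (u n) (show F.Alg from a)).trans_lt (hN n hn)⟩

/-- Evaluation at a point. -/
def ev (x : ℂ) : F.Alg →ₐ[ℂ] ℂ := (Pi.evalAlgHom ℂ (fun _ : ℂ => ℂ) x).comp F.carrier.val

theorem ext_ev {g h : F.Alg} (H : ∀ x, ev x g = ev x h) : g = h :=
  Subtype.ext (funext H)

/-- No relation between the norm and point values is assumed; the bound is automatic because
evaluation is a character of a complete normed algebra with ‖1‖ = 1. It makes every evaluation
continuous. -/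
theorem norm_ev_le (x : ℂ) (g : F.Alg) : ‖ev x g‖ ≤ ‖g‖ :=
  AlgHom.norm_apply_le_self (ev x) g

/-- Evaluation at a point as a continuous linear map. -/
def evL (x : ℂ) : F.Alg →L[ℂ] ℂ :=
  (ev x).toLinearMap.mkContinuous 1 fun g => by simpa using norm_ev_le x g

@[simp] theorem evL_apply (x : ℂ) (g : F.Alg) : evL x g = ev x g := rfl

/-- The translation `g ↦ g (· - t)`. -/
def shift (t : ℝ) : F.Alg →ₐ[ℂ] F.Alg where
  toFun g := ⟨_, F.translate_mem t g⟩
  map_one' := rfl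
  map_mul' _ _ := rfl
  map_zero' := rfl
  map_add' _ _ := rfl
  commutes' _ := rfl

@[simp] theorem norm_shift (t : ℝ) (g : F.Alg) : ‖shift t g‖ = ‖g‖ := F.nrm_translate t g

@[simp] theorem ev_shift (t : ℝ) (x : ℂ) (g : F.Alg) : ev x (shift t g) = ev (x - t) g := rfl

theorem shift_shift (s t : ℝ) (g : F.Alg) : shift s (shift t g) = shift (s + t) g :=
  ext_ev fun x => by simp [sub_sub]

@[simp] theorem shift_zero (g : F.Alg) : shift 0 g = g := ext_ev fun x => by simp

/-- Translation as a continuous linear map. -/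
def shiftL (t : ℝ) : F.Alg →L[ℂ] F.Alg :=
  (shift t).toLinearMap.mkContinuous 1 fun g => by simp

@[simp] theorem shiftL_apply (t : ℝ) (g : F.Alg) : shiftL t g = shift t g := rfl

end FunctionBanachAlgebra

open FunctionBanachAlgebra

@[simp] theorem dot_zero {d : ℕ} (ω : Fin d → ℝ) : dot 0 ω = 0 := by simp [dot]

theorem dot_add {d : ℕ} (k l : Lattice d) (ω : Fin d → ℝ) :
    dot (k + l) ω = dot k ω + dot l ω := by
  simp [dot, add_mul, Finset.sum_add_distrib]

theorem dot_sub {d : ℕ} (k l : Lattice d) (ω : Fin d → ℝ) :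
    dot (k - l) ω = dot k ω - dot l ω := by
  simp [dot, sub_mul, Finset.sum_sub_distrib]

/-! ### The crossed product algebra -/

/-- The crossed product of a function algebra with `ℤ^d`, which acts by the translations along the
frequency `ω`: absolutely summable families `(x_k)` of elements of the algebra, to be thought of
as the matrices with entries `x_{i-j}(i · ω)`. -/
def Crossed {d : ℕ} (F : FunctionBanachAlgebra) (_ω : Fin d → ℝ) : Type :=
  lp (fun _ : Lattice d => F.Alg) 1

namespace Crossed

variable {d : ℕ} {F : FunctionBanachAlgebra} {ω : Fin d → ℝ}

instance : NormedAddCommGroup (Crossed F ω) :=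
  inferInstanceAs (NormedAddCommGroup (lp (fun _ : Lattice d => F.Alg) 1))

instance : NormedSpace ℂ (Crossed F ω) :=
  inferInstanceAs (NormedSpace ℂ (lp (fun _ : Lattice d => F.Alg) 1))

instance : CompleteSpace (Crossed F ω) :=
  inferInstanceAs (CompleteSpace (lp (fun _ : Lattice d => F.Alg) 1))

/-- The coefficients of an element. -/
def coeff (x : Crossed F ω) : Lattice d → F.Alg := x.1

instance : CoeFun (Crossed F ω) fun _ => Lattice d → F.Alg := ⟨coeff⟩

/-- The element with given coefficients. -/
def mk (c : Lattice d → F.Alg) (hc : Summable fun k => ‖c k‖) : Crossed F ω :=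
  ⟨c, memℓp_gen (by simpa using hc)⟩

@[simp] theorem mk_apply (c : Lattice d → F.Alg) (hc : Summable fun k => ‖c k‖) (k : Lattice d) :
    (mk c hc : Crossed F ω) k = c k := rfl

@[ext] theorem ext {x y : Crossed F ω} (h : ∀ k, x k = y k) : x = y :=
  Subtype.ext (funext h)

@[simp] theorem add_apply (x y : Crossed F ω) (k : Lattice d) : (x + y) k = x k + y k := rfl
@[simp] theorem sub_apply (x y : Crossed F ω) (k : Lattice d) : (x - y) k = x k - y k := rfl
@[simp] theorem neg_apply (x : Crossed F ω) (k : Lattice d) : (-x) k = -x k := rfl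
@[simp] theorem zero_apply (k : Lattice d) : (0 : Crossed F ω) k = 0 := rfl
@[simp] theorem smul_apply (c : ℂ) (x : Crossed F ω) (k : Lattice d) : (c • x) k = c • x k := rfl

theorem hasSum_norm (x : Crossed F ω) : HasSum (fun k => ‖x k‖) ‖x‖ := by
  have h := lp.hasSum_norm (E := fun _ : Lattice d => F.Alg) (p := 1) (by simp) x
  simp only [ENNReal.toReal_one, Real.rpow_one] at h
  exact h

theorem summable_norm (x : Crossed F ω) : Summable fun k => ‖x k‖ := x.hasSum_norm.summable

theorem norm_eq (x : Crossed F ω) : ‖x‖ = ∑' k, ‖x k‖ := x.hasSum_norm.tsum_eq.symm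

theorem norm_apply_le (x : Crossed F ω) (k : Lattice d) : ‖x k‖ ≤ ‖x‖ :=
  le_hasSum x.hasSum_norm k fun _ _ => norm_nonneg _

theorem norm_le_of_sum_le {x : Crossed F ω} {c : ℝ}
    (h : ∀ s : Finset (Lattice d), ∑ k ∈ s, ‖x k‖ ≤ c) : ‖x‖ ≤ c :=
  x.norm_eq ▸ x.summable_norm.tsum_le_of_sum_le h

/-- The coefficient map. -/
def coeffL (k : Lattice d) : Crossed F ω →L[ℂ] F.Alg :=
  LinearMap.mkContinuous
    { toFun := fun x => x k, map_add' := fun _ _ => rfl, map_smul' := fun _ _ => rfl } 1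
    fun x => (x.norm_apply_le k).trans_eq (one_mul _).symm

@[simp] theorem coeffL_apply (k : Lattice d) (x : Crossed F ω) : coeffL k x = x k := rfl

/-- The pairs `(l, k - l)`. -/
def pairEquiv (d : ℕ) : Lattice d × Lattice d ≃ Lattice d × Lattice d where
  toFun p := (p.2, p.1 - p.2)
  invFun p := (p.1 + p.2, p.1)
  left_inv p := by simp
  right_inv p := by simp

theorem summable_norm_mul_norm (x y : Crossed F ω) :
    Summable fun p : Lattice d × Lattice d => ‖x p.2‖ * ‖y (p.1 - p.2)‖ :=
  (pairEquiv d).summable_iff.2 <|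
    x.summable_norm.mul_of_nonneg y.summable_norm (fun _ => norm_nonneg _) fun _ => norm_nonneg _

theorem summable_norm_conv (x y : Crossed F ω) (k : Lattice d) :
    Summable fun l => ‖x l‖ * ‖y (k - l)‖ :=
  (summable_norm_mul_norm x y).prod_factor k

theorem norm_term_le (x y : Crossed F ω) (k l : Lattice d) :
    ‖x l * shift (dot l ω) (y (k - l))‖ ≤ ‖x l‖ * ‖y (k - l)‖ :=
  (norm_mul_le _ _).trans_eq (by rw [norm_shift])

theorem summable_conv (x y : Crossed F ω) (k : Lattice d) :
    Summable fun l => x l * shift (dot l ω) (y (k - l)) :=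
  .of_norm_bounded (summable_norm_conv x y k) (norm_term_le x y k)

theorem norm_conv_le (x y : Crossed F ω) (k : Lattice d) :
    ‖∑' l, x l * shift (dot l ω) (y (k - l))‖ ≤ ∑' l, ‖x l‖ * ‖y (k - l)‖ :=
  tsum_of_norm_bounded (summable_norm_conv x y k).hasSum (norm_term_le x y k)

/-- Matrix multiplication in terms of diagonals: the factor y_{k-l} sits in row i - l, so it is
evaluated at (i - l)·ω, whence the translation by l·ω. -/
instance : Mul (Crossed F ω) where
  mul x y := mk (fun k => ∑' l, x l * shift (dot l ω) (y (k - l))) <|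
    .of_nonneg_of_le (fun _ => norm_nonneg _) (norm_conv_le x y) (summable_norm_mul_norm x y).prod

theorem mul_apply (x y : Crossed F ω) (k : Lattice d) :
    (x * y) k = ∑' l, x l * shift (dot l ω) (y (k - l)) := rfl

theorem norm_mul_le' (x y : Crossed F ω) : ‖x * y‖ ≤ ‖x‖ * ‖y‖ := by
  have h := summable_norm_mul_norm x y
  calc ‖x * y‖ = ∑' k, ‖(x * y) k‖ := norm_eq _
    _ ≤ ∑' k, ∑' l, ‖x l‖ * ‖y (k - l)‖ :=
        (x * y).summable_norm.tsum_le_tsum (norm_conv_le x y) h.prod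
    _ = ∑' p : Lattice d × Lattice d, ‖x p.2‖ * ‖y (p.1 - p.2)‖ := h.tsum_prod.symm
    _ = ∑' p : Lattice d × Lattice d, ‖x p.1‖ * ‖y p.2‖ :=
        (pairEquiv d).tsum_eq fun p : Lattice d × Lattice d => ‖x p.1‖ * ‖y p.2‖
    _ = ‖x‖ * ‖y‖ := by
        rw [norm_eq, norm_eq, x.summable_norm.tsum_mul_tsum y.summable_norm
          (x.summable_norm.mul_of_nonneg y.summable_norm (fun _ => norm_nonneg _)
            fun _ => norm_nonneg _)]

/-- The diagonal elements. -/
def diag (g : F.Alg) : Crossed F ω :=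
  mk (Pi.single 0 g) (summable_of_hasFiniteSupport <| (Set.finite_singleton 0).subset fun k hk => by
    by_contra h
    exact hk (by simp [Pi.single_eq_of_ne (show k ≠ 0 from h)]))

theorem diag_apply (g : F.Alg) (k : Lattice d) :
    (diag g : Crossed F ω) k = if k = 0 then g else 0 := by
  simp [diag, Pi.single_apply]

@[simp] theorem diag_apply_zero (g : F.Alg) : (diag g : Crossed F ω) 0 = g := by simp [diag_apply]

theorem diag_apply_ne (g : F.Alg) {k : Lattice d} (hk : k ≠ 0) : (diag g : Crossed F ω) k = 0 := by
  simp [diag_apply, hk]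

theorem diag_mul_apply (g : F.Alg) (x : Crossed F ω) (k : Lattice d) :
    (diag g * x : Crossed F ω) k = g * x k := by
  rw [mul_apply, tsum_eq_single 0]
  · simp
  · intro l hl; simp [diag_apply_ne g hl]

theorem mul_diag_apply (g : F.Alg) (x : Crossed F ω) (k : Lattice d) :
    (x * diag g : Crossed F ω) k = x k * shift (dot k ω) g := by
  rw [mul_apply, tsum_eq_single k]
  · simp
  · intro l hl; simp [diag_apply_ne g (sub_ne_zero.2 hl.symm)]

/-- Both sides are iterated sums of the same absolutely summable double family, because translations
are multiplicative, isometric and additive in the frequency. -/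
theorem mul_assoc' (x y z : Crossed F ω) : x * y * z = x * (y * z) := by
  ext k
  have e1 : (x * y * z) k = ∑' m, ∑' l,
      x l * shift (dot l ω) (y (m - l)) * shift (dot m ω) (z (k - m)) := by
    rw [mul_apply]
    exact tsum_congr fun m => by rw [mul_apply, (summable_conv x y m).tsum_mul_right]
  have e2 : (x * (y * z)) k = ∑' l, ∑' m,
      x l * shift (dot l ω) (y (m - l)) * shift (dot m ω) (z (k - m)) := by
    rw [mul_apply]
    refine tsum_congr fun l => ?_
    rw [mul_apply, ← shiftL_apply, (shiftL _).map_tsum (summable_conv y z _),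
      ← (((shiftL _).summable (summable_conv y z _))).tsum_mul_left, ← (Equiv.subRight l).tsum_eq]
    refine tsum_congr fun m => ?_
    rw [Equiv.subRight_apply, shiftL_apply, map_mul, shift_shift, ← dot_add, mul_assoc,
      add_sub_cancel, sub_sub_sub_cancel_right]
  rw [e1, e2]
  refine Summable.tsum_comm (f := fun l m => x l * shift (dot l ω) (y (m - l)) *
    shift (dot m ω) (z (k - m))) ?_
  refine Summable.of_norm_bounded (((Equiv.prodComm _ _).summable_iff.2
    (summable_norm_mul_norm x y)).mul_right ‖z‖) fun p => ?_
  refine (norm_mul_le _ _).trans ?_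
  rw [norm_shift]
  exact mul_le_mul (norm_term_le x y _ _) (z.norm_apply_le _) (norm_nonneg _)
    (mul_nonneg (norm_nonneg _) (norm_nonneg _))

instance : Ring (Crossed F ω) :=
  { (inferInstance : AddCommGroup (Crossed F ω)), (inferInstance : Mul (Crossed F ω)) with
    one := diag 1
    mul_assoc := mul_assoc'
    one_mul := fun x => ext fun k => (diag_mul_apply 1 x k).trans (one_mul _)
    mul_one := fun x => ext fun k => (mul_diag_apply 1 x k).trans (by rw [map_one, mul_one])
    zero_mul := fun x => ext fun k => by simp [mul_apply]
    mul_zero := fun x => ext fun k => by simp [mul_apply]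
    left_distrib := fun x y z => ext fun k => by
      simp only [add_apply, mul_apply]
      rw [← (summable_conv x y k).tsum_add (summable_conv x z k)]
      exact tsum_congr fun l => by simp [mul_add]
    right_distrib := fun x y z => ext fun k => by
      simp only [add_apply, mul_apply]
      rw [← (summable_conv x z k).tsum_add (summable_conv y z k)]
      exact tsum_congr fun l => by simp [add_mul] }

theorem one_eq : (1 : Crossed F ω) = diag 1 := rfl

instance : NormedRing (Crossed F ω) :=
  { (inferInstance : NormedAddCommGroup (Crossed F ω)), (inferInstance : Ring (Crossed F ω)) with
    norm_mul_le := norm_mul_le' }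

theorem norm_diag (g : F.Alg) : ‖(diag g : Crossed F ω)‖ = ‖g‖ := by
  rw [norm_eq, tsum_eq_single 0]
  · simp
  · intro k hk; simp [diag_apply_ne g hk]

instance : NormOneClass (Crossed F ω) := ⟨by rw [one_eq, norm_diag, norm_one]⟩

end Crossed

/-! ### Summability over the lattice -/

section Lattice

variable {d : ℕ}

theorem one_le_bracket (k : Lattice d) : 1 ≤ bracket k := le_max_left _ _

theorem bracket_pos (k : Lattice d) : 0 < bracket k := zero_lt_one.trans_le (one_le_bracket k)

theorem norm_le_bracket (k : Lattice d) : ‖k‖ ≤ bracket k := le_max_right _ _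

@[simp] theorem bracket_zero : bracket (0 : Lattice d) = 1 := by simp [bracket]

theorem one_le_norm {k : Lattice d} (hk : k ≠ 0) : 1 ≤ ‖k‖ := by
  obtain ⟨v, hv⟩ := Function.ne_iff.1 hk
  calc (1 : ℝ) ≤ ‖k v‖ := by
        rw [Int.norm_eq_abs]; exact_mod_cast Int.one_le_abs hv
    _ ≤ ‖k‖ := norm_le_pi_norm k v

theorem bracket_eq_norm {k : Lattice d} (hk : k ≠ 0) : bracket k = ‖k‖ :=
  max_eq_right (one_le_norm hk)

theorem bracket_le_add (k l : Lattice d) : bracket k ≤ bracket l + bracket (k - l) := by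
  refine max_le ?_ ?_
  · linarith [one_le_bracket l, one_le_bracket (k - l)]
  · calc ‖k‖ = ‖l + (k - l)‖ := by rw [add_sub_cancel]
      _ ≤ _ := (norm_add_le _ _).trans (add_le_add (norm_le_bracket _) (norm_le_bracket _))

theorem bracket_rpow_le (k l : Lattice d) {r : ℝ} (hr : 0 ≤ r) :
    bracket k ^ r ≤ 2 ^ r * (bracket l ^ r + bracket (k - l) ^ r) := by
  have h : bracket k ≤ 2 * max (bracket l) (bracket (k - l)) := by
    linarith [bracket_le_add k l, le_max_left (bracket l) (bracket (k - l)),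
      le_max_right (bracket l) (bracket (k - l))]
  have hm : 0 < max (bracket l) (bracket (k - l)) := lt_max_of_lt_left (bracket_pos l)
  refine (Real.rpow_le_rpow (bracket_pos k).le h hr).trans ?_
  rw [Real.mul_rpow zero_le_two hm.le]
  refine mul_le_mul_of_nonneg_left ?_ (by positivity)
  have h1 := Real.rpow_nonneg (bracket_pos l).le r
  have h2 := Real.rpow_nonneg (bracket_pos (k - l)).le r
  rcases max_cases (bracket l) (bracket (k - l)) with h | h <;> rw [h.1] <;> linarith

/-- ℤ^d is embedded isometrically as a full-rank lattice in ℝ^d with the sup norm, where the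
convergence of ∑ ‖k‖^{-r} is known; the term k = 0, on which ⟨k⟩ and |k| differ, is added by hand.
-/
theorem summable_bracket {r : ℝ} (hr : (d : ℝ) < r) :
    Summable fun k : Lattice d => bracket k ^ (-r) := by
  let L : Submodule ℤ (Fin d → ℝ) := Submodule.span ℤ (Set.range (Pi.basisFun ℝ (Fin d)))
  have hL : Module.finrank ℤ L = d := by
    rw [ZLattice.rank ℝ L]; simp
  let ι : Lattice d → L := fun k => ⟨fun v => (k v : ℝ), by
    rw [Module.Basis.mem_span_iff_repr_mem]
    exact fun v => ⟨k v, by simp⟩⟩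
  have hι : Function.Injective ι := fun k l h => by
    funext v
    have : (k v : ℝ) = l v := congrFun (congrArg Subtype.val h) v
    exact_mod_cast this
  have hn : ∀ k, ‖ι k‖ = ‖k‖ := fun k => by
    change ‖fun v => (k v : ℝ)‖ = ‖k‖
    simp only [Pi.norm_def]
    congr 2
  have h1 : Summable fun k : Lattice d => ‖k‖ ^ (-r) := by
    have := (ZLattice.summable_norm_rpow L (-r) (by rw [hL]; linarith)).comp_injective hι
    simpa only [Function.comp_def, hn] using this
  have h2 : Summable fun k : Lattice d => (Pi.single 0 1 : Lattice d → ℝ) k :=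
    (hasSum_pi_single 0 1).summable
  refine (h1.add h2).of_nonneg_of_le (fun k => Real.rpow_nonneg (bracket_pos k).le _) fun k => ?_
  rcases eq_or_ne k 0 with rfl | hk
  · simp [Real.rpow_nonneg]
  · simp [bracket_eq_norm hk, hk]

/-- The sum `∑ ⟨l⟩^{-2α}`. -/
def bracketSum (d : ℕ) (α : ℝ) : ℝ := ∑' l : Lattice d, bracket l ^ (-(2 * α))

/-- The normalization of the weights which makes the weighted norms submultiplicative. -/
def wtConst (d : ℕ) (α : ℝ) : ℝ := Real.sqrt (2 ^ (2 * α + 1) * bracketSum d α)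

/-- The weight `K ⟨k⟩^α e^{σ|k|}`. -/
def wt (α σ : ℝ) (k : Lattice d) : ℝ := wtConst d α * bracket k ^ α * Real.exp (σ * ‖k‖)

variable {α σ : ℝ} (hα : (d : ℝ) / 2 < α)
include hα

theorem summable_bracket_two : Summable fun l : Lattice d => bracket l ^ (-(2 * α)) :=
  summable_bracket (by linarith)

theorem one_le_bracketSum : 1 ≤ bracketSum d α := by
  have := (summable_bracket_two hα).le_tsum 0 fun k _ => Real.rpow_nonneg (bracket_pos k).le _
  simpa [bracketSum] using this

theorem alpha_pos : 0 < α := lt_of_le_of_lt (by positivity) hα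

theorem bracketSum_le_wtConst_sq : bracketSum d α ≤ wtConst d α ^ 2 := by
  have h := one_le_bracketSum hα
  rw [wtConst, Real.sq_sqrt (by positivity)]
  have : (1 : ℝ) ≤ 2 ^ (2 * α + 1) :=
    Real.one_le_rpow one_le_two (by linarith [alpha_pos hα])
  nlinarith

theorem one_le_wtConst : 1 ≤ wtConst d α := by
  have h := (one_le_bracketSum hα).trans (bracketSum_le_wtConst_sq hα)
  have h0 : 0 ≤ wtConst d α := Real.sqrt_nonneg _
  nlinarith

theorem wt_pos (σ : ℝ) (k : Lattice d) : 0 < wt α σ k := by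
  have := one_le_wtConst hα
  have := bracket_pos k
  unfold wt
  positivity

theorem wt_mono {σ' : ℝ} (h : σ' ≤ σ) (k : Lattice d) : wt α σ' k ≤ wt α σ k := by
  have := one_le_wtConst hα
  have := bracket_pos k
  unfold wt
  gcongr

theorem bracket_le_wt (hσ : 0 ≤ σ) (k : Lattice d) : bracket k ^ α ≤ wt α σ k := by
  have h1 := one_le_wtConst hα
  have h2 : 0 < bracket k ^ α := Real.rpow_pos_of_pos (bracket_pos k) _
  have h3 : 1 ≤ Real.exp (σ * ‖k‖) := Real.one_le_exp (by positivity)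
  unfold wt
  nlinarith [mul_le_mul h1 h3 zero_le_one (by linarith)]

theorem one_le_wt (hσ : 0 ≤ σ) (k : Lattice d) : 1 ≤ wt α σ k :=
  (Real.one_le_rpow (one_le_bracket k) (alpha_pos hα).le).trans (bracket_le_wt hα hσ k)

/-- By Cauchy-Schwarz this makes the weighted ℓ² norm dominate the ℓ¹ norm with constant 1. -/
theorem sum_wt_inv_sq_le (hσ : 0 ≤ σ) (s : Finset (Lattice d)) :
    ∑ k ∈ s, ((wt α σ k)⁻¹) ^ 2 ≤ 1 := by
  have hK := one_le_wtConst hα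
  have h : ∀ k ∈ s, ((wt α σ k)⁻¹) ^ 2 ≤ (wtConst d α ^ 2)⁻¹ * bracket k ^ (-(2 * α)) := by
    intro k _
    have hb := bracket_pos k
    have h3 : 1 ≤ Real.exp (σ * ‖k‖) := Real.one_le_exp (by positivity)
    rw [Real.rpow_neg hb.le, mul_comm 2 α, Real.rpow_mul hb.le, Real.rpow_two, ← mul_inv,
      ← mul_pow, inv_pow]
    have : wtConst d α * bracket k ^ α ≤ wt α σ k := le_mul_of_one_le_right (by positivity) h3
    gcongr
  refine (Finset.sum_le_sum h).trans ?_
  rw [← Finset.mul_sum, inv_mul_le_iff₀ (by positivity), mul_one]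
  refine le_trans ?_ (bracketSum_le_wtConst_sq hα)
  exact (summable_bracket_two hα).sum_le_tsum s fun k _ => Real.rpow_nonneg (bracket_pos k).le _

/-- The Cauchy-Schwarz factor behind submultiplicativity. The exponential parts are
submultiplicative, and ⟨k⟩^{2α} ≤ 2^{2α}(⟨l⟩^{2α} + ⟨k-l⟩^{2α}) splits the squared quotient into two
sums of ⟨·⟩^{-2α}, finite since α > d/2. `wtConst` is chosen so that together they give 1. -/
theorem sum_wt_conv_le (hσ : 0 ≤ σ) (k : Lattice d) (s : Finset (Lattice d)) :
    ∑ l ∈ s, (wt α σ k / (wt α σ l * wt α σ (k - l))) ^ 2 ≤ 1 := by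
  have hK := one_le_wtConst hα
  have h0 := alpha_pos hα
  have hS := one_le_bracketSum hα
  have hK2 : wtConst d α ^ 2 = 2 ^ (2 * α + 1) * bracketSum d α := by
    rw [wtConst, Real.sq_sqrt (by positivity)]
  have h : ∀ l ∈ s, (wt α σ k / (wt α σ l * wt α σ (k - l))) ^ 2 ≤
      (wtConst d α ^ 2)⁻¹ * 2 ^ (2 * α) *
        (bracket (k - l) ^ (-(2 * α)) + bracket l ^ (-(2 * α))) := by
    intro l _
    have hk := bracket_pos k
    have hl := bracket_pos l
    have hkl := bracket_pos (k - l)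
    have e1 : Real.exp (σ * ‖k‖) ≤ Real.exp (σ * ‖l‖) * Real.exp (σ * ‖k - l‖) := by
      rw [← Real.exp_add, ← mul_add]
      have : ‖k‖ ≤ ‖l‖ + ‖k - l‖ := by simpa using norm_add_le l (k - l)
      gcongr
    have e2 : wt α σ k / (wt α σ l * wt α σ (k - l)) ≤
        (wtConst d α)⁻¹ * (bracket k ^ α / (bracket l ^ α * bracket (k - l) ^ α)) := by
      rw [div_le_iff₀ (mul_pos (wt_pos hα _ _) (wt_pos hα _ _))]
      have : (wtConst d α)⁻¹ * (bracket k ^ α / (bracket l ^ α * bracket (k - l) ^ α)) *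
          (wt α σ l * wt α σ (k - l)) = wtConst d α * bracket k ^ α *
          (Real.exp (σ * ‖l‖) * Real.exp (σ * ‖k - l‖)) := by
        unfold wt
        field_simp
      rw [this]
      unfold wt
      gcongr
    have e3 : (bracket k ^ α / (bracket l ^ α * bracket (k - l) ^ α)) ^ 2 ≤
        2 ^ (2 * α) * (bracket (k - l) ^ (-(2 * α)) + bracket l ^ (-(2 * α))) := by
      have hsq : ∀ j : Lattice d, (bracket j ^ α) ^ 2 = bracket j ^ (2 * α) := fun j => by
        rw [mul_comm 2 α, Real.rpow_mul (bracket_pos j).le, Real.rpow_two]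
      rw [div_pow, mul_pow, hsq, hsq, hsq, Real.rpow_neg hl.le, Real.rpow_neg hkl.le,
        div_le_iff₀ (by positivity)]
      refine (bracket_rpow_le k l (by linarith : 0 ≤ 2 * α)).trans_eq ?_
      have := (Real.rpow_pos_of_pos hl (2 * α)).ne'
      have := (Real.rpow_pos_of_pos hkl (2 * α)).ne'
      field_simp
    calc (wt α σ k / (wt α σ l * wt α σ (k - l))) ^ 2
        ≤ ((wtConst d α)⁻¹ * (bracket k ^ α / (bracket l ^ α * bracket (k - l) ^ α))) ^ 2 := by
          have := wt_pos hα σ k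
          have := wt_pos hα σ l
          have := wt_pos hα σ (k - l)
          gcongr
      _ ≤ _ := by
          rw [mul_pow, inv_pow, mul_assoc]
          gcongr
  have hA : ∑ l ∈ s, bracket (k - l) ^ (-(2 * α)) ≤ bracketSum d α := by
    have hs := (Equiv.subLeft k).summable_iff.2 (summable_bracket_two hα)
    refine (hs.sum_le_tsum s fun l _ => Real.rpow_nonneg (bracket_pos _).le _).trans_eq ?_
    exact (Equiv.subLeft k).tsum_eq fun l : Lattice d => bracket l ^ (-(2 * α))
  have hB : ∑ l ∈ s, bracket l ^ (-(2 * α)) ≤ bracketSum d α :=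
    (summable_bracket_two hα).sum_le_tsum s fun k _ => Real.rpow_nonneg (bracket_pos k).le _
  refine (Finset.sum_le_sum h).trans ?_
  rw [← Finset.mul_sum, Finset.sum_add_distrib, mul_assoc, inv_mul_le_iff₀ (by positivity), hK2,
    Real.rpow_add two_pos, Real.rpow_one]
  have : (0 : ℝ) < 2 ^ (2 * α) := by positivity
  nlinarith

end Lattice

/-! ### Weighted square sums -/

/-- The family `c` has weighted `ℓ²` norm at most `b`. -/
def Bd {d : ℕ} {E : Type*} [NormedAddCommGroup E] (α σ : ℝ) (c : Lattice d → E) (b : ℝ) : Prop :=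
  0 ≤ b ∧ ∀ s : Finset (Lattice d), ∑ k ∈ s, (wt α σ k * ‖c k‖) ^ 2 ≤ b ^ 2

namespace Bd

variable {d : ℕ} {E : Type*} [NormedAddCommGroup E] {α σ σ' b b' : ℝ} {c c' : Lattice d → E}

theorem mono (h : Bd α σ c b) (hb : b ≤ b') : Bd α σ c b' :=
  ⟨h.1.trans hb, fun s => (h.2 s).trans (pow_le_pow_left₀ h.1 hb 2)⟩

theorem zero (hb : 0 ≤ b) : Bd α σ (0 : Lattice d → E) b :=
  ⟨hb, fun s => by simpa using sq_nonneg b⟩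

theorem neg (h : Bd α σ c b) : Bd α σ (fun k => -c k) b :=
  ⟨h.1, fun s => by simpa using h.2 s⟩

variable (hα : (d : ℝ) / 2 < α)
include hα

theorem of_le {E' : Type*} [NormedAddCommGroup E'] {c' : Lattice d → E'} {G : ℝ} (hG : 0 ≤ G)
    (h : Bd α σ c b) (hc : ∀ k, wt α σ' k * ‖c' k‖ ≤ G * (wt α σ k * ‖c k‖)) :
    Bd α σ' c' (G * b) := by
  refine ⟨mul_nonneg hG h.1, fun s => ?_⟩
  calc ∑ k ∈ s, (wt α σ' k * ‖c' k‖) ^ 2 ≤ ∑ k ∈ s, G ^ 2 * (wt α σ k * ‖c k‖) ^ 2 := by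
        refine Finset.sum_le_sum fun k _ => ?_
        rw [← mul_pow]
        exact pow_le_pow_left₀ (mul_nonneg (wt_pos hα _ _).le (norm_nonneg _)) (hc k) 2
    _ ≤ (G * b) ^ 2 := by
        rw [← Finset.mul_sum, mul_pow]
        exact mul_le_mul_of_nonneg_left (h.2 s) (sq_nonneg G)

theorem mono_weight (hσ : σ' ≤ σ) (h : Bd α σ c b) : Bd α σ' c b := by
  have := of_le hα zero_le_one h (σ' := σ') (c' := c) fun k => by
    rw [one_mul]; exact mul_le_mul_of_nonneg_right (wt_mono hα hσ k) (norm_nonneg _)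
  rwa [one_mul] at this

theorem of_norm_le {E' : Type*} [NormedAddCommGroup E'] {c' : Lattice d → E'}
    (h : Bd α σ c b) (hc : ∀ k, ‖c' k‖ ≤ ‖c k‖) : Bd α σ c' b := by
  have := of_le hα zero_le_one h (σ' := σ) (c' := c') fun k => by
    rw [one_mul]; exact mul_le_mul_of_nonneg_left (hc k) (wt_pos hα _ _).le
  rwa [one_mul] at this

theorem wt_mul_norm_le (h : Bd α σ c b) (k : Lattice d) : wt α σ k * ‖c k‖ ≤ b := by
  have := h.2 {k}
  rw [Finset.sum_singleton] at this
  exact (pow_le_pow_iff_left₀ (mul_nonneg (wt_pos hα _ _).le (norm_nonneg _)) h.1 two_ne_zero).1 this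

theorem norm_apply_le (hσ : 0 ≤ σ) (h : Bd α σ c b) (k : Lattice d) : ‖c k‖ ≤ b :=
  (le_mul_of_one_le_left (norm_nonneg _) (one_le_wt hα hσ k)).trans (h.wt_mul_norm_le hα k)

theorem sum_norm_le (hσ : 0 ≤ σ) (h : Bd α σ c b) (s : Finset (Lattice d)) :
    ∑ k ∈ s, ‖c k‖ ≤ b := by
  have e : ∑ k ∈ s, ‖c k‖ = ∑ k ∈ s, (wt α σ k * ‖c k‖) * (wt α σ k)⁻¹ :=
    Finset.sum_congr rfl fun k _ => by
      have := (wt_pos hα σ k).ne'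
      field_simp
  have h1 := Finset.sum_mul_sq_le_sq_mul_sq s (fun k => wt α σ k * ‖c k‖) fun k => (wt α σ k)⁻¹
  rw [← e] at h1
  refine le_of_sq_le_sq ?_ h.1
  calc (∑ k ∈ s, ‖c k‖) ^ 2 ≤ _ := h1
    _ ≤ b ^ 2 * 1 := mul_le_mul (h.2 s) (sum_wt_inv_sq_le hα hσ s)
        (Finset.sum_nonneg fun _ _ => sq_nonneg _) (sq_nonneg b)
    _ = b ^ 2 := mul_one _

theorem summable_norm (hσ : 0 ≤ σ) (h : Bd α σ c b) : Summable fun k => ‖c k‖ :=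
  summable_of_sum_le (fun _ => norm_nonneg _) (h.sum_norm_le hα hσ)

theorem add (h : Bd α σ c b) (h' : Bd α σ c' b') : Bd α σ (fun k => c k + c' k) (b + b') := by
  refine ⟨add_nonneg h.1 h'.1, fun s => ?_⟩
  have h1 := Finset.sum_mul_sq_le_sq_mul_sq s (fun k => wt α σ k * ‖c k‖) fun k => wt α σ k * ‖c' k‖
  have h2 : ∑ k ∈ s, (wt α σ k * ‖c k‖) * (wt α σ k * ‖c' k‖) ≤ b * b' := by
    refine le_of_sq_le_sq ?_ (mul_nonneg h.1 h'.1)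
    rw [mul_pow]
    exact h1.trans (mul_le_mul (h.2 s) (h'.2 s) (Finset.sum_nonneg fun _ _ => sq_nonneg _)
      (sq_nonneg _))
  calc ∑ k ∈ s, (wt α σ k * ‖c k + c' k‖) ^ 2
      ≤ ∑ k ∈ s, (wt α σ k * ‖c k‖ + wt α σ k * ‖c' k‖) ^ 2 := by
        refine Finset.sum_le_sum fun k _ => ?_
        have := (wt_pos hα σ k).le
        rw [← mul_add]
        have := norm_add_le (c k) (c' k)
        gcongr
    _ = ∑ k ∈ s, (wt α σ k * ‖c k‖) ^ 2 + 2 * ∑ k ∈ s, (wt α σ k * ‖c k‖) * (wt α σ k * ‖c' k‖)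
          + ∑ k ∈ s, (wt α σ k * ‖c' k‖) ^ 2 := by
        rw [Finset.mul_sum, ← Finset.sum_add_distrib, ← Finset.sum_add_distrib]
        exact Finset.sum_congr rfl fun k _ => by ring
    _ ≤ (b + b') ^ 2 := by nlinarith [h.2 s, h'.2 s]

theorem sub (h : Bd α σ c b) (h' : Bd α σ c' b') : Bd α σ (fun k => c k - c' k) (b + b') := by
  simpa only [sub_eq_add_neg] using h.add hα h'.neg

-- A form of Fatou's lemma: the bound is tested on finite sets, so coefficientwise convergence
-- suffices.
omit hα in
theorem of_tendsto {u : ℕ → Lattice d → E} (h : ∀ n, Bd α σ (u n) b)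
    (hu : ∀ k, Tendsto (fun n => u n k) atTop (𝓝 (c k))) : Bd α σ c b :=
  ⟨(h 0).1, fun s => le_of_tendsto
    (tendsto_finsetSum s fun k _ => ((hu k).norm.const_mul _).pow 2)
    (Eventually.of_forall fun n => (h n).2 s)⟩

end Bd

/-! ### Weighted estimates in the crossed product -/

namespace Crossed

variable {d : ℕ} {F : FunctionBanachAlgebra} {ω : Fin d → ℝ} {α σ a b : ℝ} {x y : Crossed F ω}

section Bounds

variable (hα : (d : ℝ) / 2 < α)
include hα

theorem bd_add (hx : Bd α σ x.coeff a) (hy : Bd α σ y.coeff b) :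
    Bd α σ (x + y).coeff (a + b) := hx.add hα hy

theorem bd_sub (hx : Bd α σ x.coeff a) (hy : Bd α σ y.coeff b) :
    Bd α σ (x - y).coeff (a + b) := hx.sub hα hy

theorem bd_smul {c : ℂ} (hc : ‖c‖ ≤ 1) (hx : Bd α σ x.coeff a) : Bd α σ (c • x).coeff a :=
  hx.of_norm_le hα fun k =>
    (norm_smul_le c (x k)).trans (mul_le_of_le_one_left (norm_nonneg _) hc)

theorem bd_diag (hx : Bd α σ x.coeff a) : Bd α σ (diag (x 0) : Crossed F ω).coeff a :=
  hx.of_norm_le hα fun k => by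
    rcases eq_or_ne k 0 with rfl | hk
    · rw [diag_apply_zero]
    · simp [diag_apply_ne _ hk]

theorem bd_sub_diag (hx : Bd α σ x.coeff a) : Bd α σ (x - diag (x 0)).coeff a :=
  hx.of_norm_le hα fun k => by
    rcases eq_or_ne k 0 with rfl | hk
    · simp
    · simp [diag_apply_ne _ hk]

theorem norm_le_of_bd (hσ : 0 ≤ σ) (hx : Bd α σ x.coeff a) : ‖x‖ ≤ a :=
  norm_le_of_sum_le (hx.sum_norm_le hα hσ)

/-- Cauchy-Schwarz against `sum_wt_conv_le` bounds the square of the k-th weighted coefficient by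
the convolution of the sequences of squares A² and B²; summing over k is Young's inequality for ℓ¹ *
ℓ¹. -/
theorem bd_mul (hσ : 0 ≤ σ) (hx : Bd α σ x.coeff a) (hy : Bd α σ y.coeff b) :
    Bd α σ (x * y).coeff (a * b) := by
  set A : Lattice d → ℝ := fun l => wt α σ l * ‖x l‖ with hA
  set B : Lattice d → ℝ := fun l => wt α σ l * ‖y l‖ with hB
  have hB1 : ∀ l, B l ^ 2 ≤ b ^ 2 := fun l => by simpa using hy.2 {l}
  have hAs : Summable fun l => A l ^ 2 := summable_of_sum_le (fun _ => sq_nonneg _) hx.2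
  have hAt : ∑' l, A l ^ 2 ≤ a ^ 2 := hAs.tsum_le_of_sum_le hx.2
  have hABs : ∀ k, Summable fun l => A l ^ 2 * B (k - l) ^ 2 := fun k =>
    (hAs.mul_right (b ^ 2)).of_nonneg_of_le (fun _ => by positivity) fun l =>
      mul_le_mul_of_nonneg_left (hB1 _) (sq_nonneg _)
  have key : ∀ k, (wt α σ k * ‖(x * y) k‖) ^ 2 ≤ ∑' l, A l ^ 2 * B (k - l) ^ 2 := by
    intro k
    have hS : 0 ≤ ∑' l, A l ^ 2 * B (k - l) ^ 2 := tsum_nonneg fun l => by positivity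
    have hwk := wt_pos hα σ k
    have h1 : wt α σ k * ‖(x * y) k‖ ≤ Real.sqrt (∑' l, A l ^ 2 * B (k - l) ^ 2) := by
      refine (mul_le_mul_of_nonneg_left (norm_conv_le x y k) hwk.le).trans ?_
      rw [← (summable_norm_conv x y k).tsum_mul_left]
      refine ((summable_norm_conv x y k).mul_left _).tsum_le_of_sum_le fun s => ?_
      refine Real.le_sqrt_of_sq_le ?_
      have e : ∑ l ∈ s, wt α σ k * (‖x l‖ * ‖y (k - l)‖) =
          ∑ l ∈ s, A l * B (k - l) * (wt α σ k / (wt α σ l * wt α σ (k - l))) := by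
        refine Finset.sum_congr rfl fun l _ => ?_
        have := (wt_pos hα σ l).ne'
        have := (wt_pos hα σ (k - l)).ne'
        simp only [hA, hB]
        field_simp
      rw [e]
      refine (Finset.sum_mul_sq_le_sq_mul_sq _ _ _).trans ?_
      rw [← mul_one (∑' l, _)]
      refine mul_le_mul ?_ (sum_wt_conv_le hα hσ k s)
        (Finset.sum_nonneg fun _ _ => sq_nonneg _) hS
      simp only [mul_pow]
      exact (hABs k).sum_le_tsum s fun l _ => by positivity
    calc (wt α σ k * ‖(x * y) k‖) ^ 2 ≤ Real.sqrt (∑' l, A l ^ 2 * B (k - l) ^ 2) ^ 2 := by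
          gcongr
      _ = _ := Real.sq_sqrt hS
  refine ⟨mul_nonneg hx.1 hy.1, fun s => ?_⟩
  calc ∑ k ∈ s, (wt α σ k * ‖(x * y) k‖) ^ 2
      ≤ ∑ k ∈ s, ∑' l, A l ^ 2 * B (k - l) ^ 2 := Finset.sum_le_sum fun k _ => key k
    _ = ∑' l, ∑ k ∈ s, A l ^ 2 * B (k - l) ^ 2 :=
        (Summable.tsum_finsetSum fun k _ => hABs k).symm
    _ ≤ ∑' l, A l ^ 2 * b ^ 2 := by
        refine (summable_sum fun k _ => hABs k).tsum_le_tsum (fun l => ?_) (hAs.mul_right _)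
        rw [← Finset.mul_sum]
        refine mul_le_mul_of_nonneg_left ?_ (sq_nonneg _)
        have := hy.2 (s.map (Equiv.subRight l).toEmbedding)
        rwa [Finset.sum_map] at this
    _ ≤ (a * b) ^ 2 := by
        rw [hAs.tsum_mul_right, mul_pow]
        exact mul_le_mul_of_nonneg_right hAt (sq_nonneg b)

omit hα in
theorem tendsto_coeff {u : ℕ → Crossed F ω} (hu : Tendsto u atTop (𝓝 x)) (k : Lattice d) :
    Tendsto (fun n => u n k) atTop (𝓝 (x k)) :=
  ((coeffL k).continuous.tendsto x).comp hu

omit hα in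
theorem bd_of_tendsto {u : ℕ → Crossed F ω} (h : ∀ n, Bd α σ (u n).coeff b)
    (hu : Tendsto u atTop (𝓝 x)) : Bd α σ x.coeff b :=
  Bd.of_tendsto h (tendsto_coeff hu)

theorem bd_pow_succ (hσ : 0 ≤ σ) (hx : Bd α σ x.coeff a) (n : ℕ) :
    Bd α σ (x ^ (n + 1)).coeff (a ^ (n + 1)) := by
  induction n with
  | zero => simpa using hx
  | succ n ih => rw [pow_succ x, pow_succ a]; exact bd_mul hα hσ ih hx

/-- Elements close to `1` are invertible, with an inverse close to `1` in the weighted norm. -/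
theorem exists_inverse_one_add (hσ : 0 ≤ σ) (hx : Bd α σ x.coeff a) (ha : a ≤ 1 / 2) :
    ∃ y : Crossed F ω, (1 + x) * (1 + y) = 1 ∧ (1 + y) * (1 + x) = 1 ∧
      Bd α σ y.coeff (2 * a) := by
  have ha0 := hx.1
  have hx' : Bd α σ (-x).coeff a := hx.neg
  have hn : ‖-x‖ < 1 := (norm_le_of_bd hα hσ hx').trans_lt (by linarith)
  have hs := summable_geometric_of_norm_lt_one hn
  have e1 := geom_series_mul_neg (-x) hn
  have e2 := mul_neg_geom_series (-x) hn
  rw [sub_neg_eq_add] at e1 e2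
  have e0 : ∑' n : ℕ, (-x) ^ n = 1 + ∑' n : ℕ, (-x) ^ (n + 1) := by
    rw [hs.tsum_eq_zero_add, pow_zero]
  refine ⟨∑' n : ℕ, (-x) ^ (n + 1), by rw [← e0, e2], by rw [← e0, e1], ?_⟩
  have hs' : Summable fun n : ℕ => (-x) ^ (n + 1) := (summable_nat_add_iff 1).2 hs
  refine bd_of_tendsto (fun n => ?_) hs'.hasSum.tendsto_sum_nat
  have hpart : ∀ n : ℕ, Bd α σ (∑ i ∈ Finset.range n, (-x) ^ (i + 1)).coeff
      (∑ i ∈ Finset.range n, a ^ (i + 1)) := by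
    intro n
    induction n with
    | zero => exact Bd.zero (by simp)
    | succ n ih =>
      rw [Finset.sum_range_succ, Finset.sum_range_succ]
      exact bd_add hα ih (bd_pow_succ hα hσ hx' n)
  refine (hpart n).mono ?_
  -- The subtracted term is what lets the induction close for a ≤ 1/2.
  have hgeo : ∀ n : ℕ, ∑ i ∈ Finset.range n, a ^ (i + 1) ≤ 2 * a - 2 * a ^ (n + 1) := by
    intro n
    induction n with
    | zero => simp
    | succ n ih =>
      rw [Finset.sum_range_succ]
      have : a ^ (n + 1 + 1) ≤ a ^ (n + 1) / 2 := by
        rw [pow_succ a (n + 1)]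
        have : 0 ≤ a ^ (n + 1) := by positivity
        nlinarith
      linarith
  have := hgeo n
  have : 0 ≤ a ^ (n + 1) := by positivity
  linarith

end Bounds

/-! ### Commutation relations with multiplication operators -/

/-- `fL Q - Q fR = Y`, where the functions `fL` and `fR` are viewed as diagonal matrices. -/
def Comm (fL fR : ℂ → ℂ) (Q Y : Crossed F ω) : Prop :=
  ∀ (k : Lattice d) (x : ℂ), (fL x - fR (x - dot k ω)) * ev x (Q k) = ev x (Y k)

theorem hasSum_ev_mul (p q : Crossed F ω) (k : Lattice d) (x : ℂ) :
    HasSum (fun l => ev x (p l) * ev (x - dot l ω) (q (k - l))) (ev x ((p * q) k)) := by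
  have := (evL x).hasSum (summable_conv p q k).hasSum
  simpa [← mul_apply] using this

theorem sub_dot_sub_dot (x : ℂ) (k l : Lattice d) :
    x - (dot l ω : ℂ) - (dot (k - l) ω : ℂ) = x - dot k ω := by
  rw [dot_sub]; push_cast; ring

namespace Comm

variable {f fL fM fR : ℂ → ℂ} {P Q X Y Z Y' Q' : Crossed F ω}

theorem add (h : Comm fL fR Q Y) (h' : Comm fL fR Q' Y') : Comm fL fR (Q + Q') (Y + Y') :=
  fun k x => by rw [add_apply, add_apply, map_add, map_add, mul_add, h k x, h' k x]

theorem neg (h : Comm fL fR Q Y) : Comm fL fR (-Q) (-Y) :=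
  fun k x => by rw [neg_apply, neg_apply, map_neg, map_neg, mul_neg, h k x]

theorem sub (h : Comm fL fR Q Y) (h' : Comm fL fR Q' Y') : Comm fL fR (Q - Q') (Y - Y') := by
  simpa only [sub_eq_add_neg] using h.add h'.neg

theorem zero : Comm fL fR (0 : Crossed F ω) 0 := fun k x => by simp

theorem one : Comm f f (1 : Crossed F ω) 0 := fun k x => by
  rcases eq_or_ne k 0 with rfl | hk
  · simp
  · simp [one_eq, diag_apply_ne _ hk]

/-- The Leibniz rule. In the l-th term of the convolution the intermediate potential occurs at x -
l·ω with both signs and cancels, so the potentials need not be bounded. -/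
theorem mul (h : Comm fL fM Q Y) (h' : Comm fM fR X Z) :
    Comm fL fR (Q * X) (Y * X + Q * Z) := fun k x => by
  have h1 := (hasSum_ev_mul Q X k x).mul_left (fL x - fR (x - dot k ω))
  have h2 := (hasSum_ev_mul Y X k x).add (hasSum_ev_mul Q Z k x)
  rw [← map_add, ← add_apply] at h2
  refine h1.unique (Eq.subst (motive := fun φ => HasSum φ _) (funext fun l => ?_) h2)
  have e1 := h l x
  have e2 := h' (k - l) (x - dot l ω)
  rw [sub_dot_sub_dot] at e2
  rw [← e1, ← e2]
  ring

theorem add_left (h : Comm fL fR Q Y) (g : F.Alg) :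
    Comm (fun x => fL x + ev x g) fR Q (Y + diag g * Q) := fun k x => by
  rw [add_apply, diag_mul_apply, map_add, map_mul, ← h k x]
  ring

theorem add_right (h : Comm fL fR Q Y) (g : F.Alg) :
    Comm fL (fun x => fR x + ev x g) Q (Y - Q * diag g) := fun k x => by
  rw [sub_apply, mul_diag_apply, map_sub, map_mul, ← h k x, ev_shift]
  ring

/-- The relation is closed: it involves one coefficient and one point at a time, and both
coefficients and evaluations are continuous. -/
theorem of_tendsto {fLn fRn : ℕ → ℂ → ℂ} {Qn Yn : ℕ → Crossed F ω}
    (h : ∀ n, Comm (fLn n) (fRn n) (Qn n) (Yn n))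
    (hL : ∀ x, Tendsto (fun n => fLn n x) atTop (𝓝 (fL x)))
    (hR : ∀ x, Tendsto (fun n => fRn n x) atTop (𝓝 (fR x)))
    (hQ : Tendsto Qn atTop (𝓝 Q)) (hY : Tendsto Yn atTop (𝓝 Y)) : Comm fL fR Q Y := by
  intro k x
  have e : ∀ {u : ℕ → Crossed F ω} {v : Crossed F ω}, Tendsto u atTop (𝓝 v) →
      Tendsto (fun n => ev x (u n k)) atTop (𝓝 (ev x (v k))) := fun hu =>
    ((evL x).continuous.tendsto _).comp (tendsto_coeff hu k)
  have h1 := ((hL x).sub (hR (x - dot k ω))).mul (e hQ)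
  exact tendsto_nhds_unique (h1.congr fun n => h n k x) (e hY)

/-- The commutation relation for the inverse of an element close to `1`. -/
theorem inverse (h : Comm f f X Z) (hX : ‖X‖ ≤ 1 / 2) (hP' : (1 + X) * P = 1) :
    Comm f f P (-(P * Z * P)) := by
  -- Multiplying the relation by P is not legitimate, since [f, P] is not yet known to have summable
  -- coefficients. Instead P is approximated by S_0 = 0, S_{n+1} = 1 - X S_n, whose commutators with
  -- f are given by the Leibniz rule. These converge to -P Z P, the error obeying b_{n+1} ≤ b_n / 2
  -- + 2^{-n} ‖Z‖ ‖P‖; this explains the term linear in n.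
  have hrec : ∀ n : ℕ, ∃ p : Crossed F ω × Crossed F ω,
      Comm f f p.1 p.2 ∧ ‖p.1 - P‖ ≤ (1 / 2) ^ n * ‖P‖ ∧
      ‖p.2 + P * Z * P‖ ≤ (1 / 2) ^ n * (‖P * Z * P‖ + 2 * n * (‖Z‖ * ‖P‖)) := by
    intro n
    induction n with
    | zero => exact ⟨(0, 0), zero, by simp, by simp⟩
    | succ n ih =>
      obtain ⟨⟨S, Y⟩, h1, h2, h3⟩ := ih
      have eP : P = 1 - X * P := by rw [← hP']; noncomm_ring
      have eP' : P * Z * P = Z * P - X * (P * Z * P) := by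
        have : (1 + X) * (P * Z * P) = Z * P := by
          rw [← mul_assoc, ← mul_assoc, hP', one_mul]
        rw [← this]; noncomm_ring
      refine ⟨(1 - X * S, 0 - (Z * S + X * Y)), one.sub (h.mul h1), ?_, ?_⟩
      · have e : (1 - X * S) - P = -(X * (S - P)) := by
          nth_rewrite 1 [eP]; noncomm_ring
        calc ‖(1 - X * S) - P‖ ≤ ‖X‖ * ‖S - P‖ := by
              rw [e, norm_neg]; exact norm_mul_le _ _
          _ ≤ 1 / 2 * ((1 / 2) ^ n * ‖P‖) := by gcongr
          _ = _ := by ring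
      · have e : (0 - (Z * S + X * Y)) + P * Z * P = -(Z * (S - P)) - X * (Y + P * Z * P) := by
          nth_rewrite 1 [eP']; noncomm_ring
        calc ‖(0 - (Z * S + X * Y)) + P * Z * P‖
            ≤ ‖Z‖ * ‖S - P‖ + ‖X‖ * ‖Y + P * Z * P‖ := by
              rw [e]
              refine (norm_sub_le _ _).trans ?_
              rw [norm_neg]
              exact add_le_add (norm_mul_le _ _) (norm_mul_le _ _)
          _ ≤ ‖Z‖ * ((1 / 2) ^ n * ‖P‖) + 1 / 2 * ((1 / 2) ^ n *
              (‖P * Z * P‖ + 2 * n * (‖Z‖ * ‖P‖))) := by gcongr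
          _ = _ := by push_cast; ring
  choose p hp using hrec
  have t0 : Tendsto (fun n : ℕ => (1 / 2 : ℝ) ^ n) atTop (𝓝 0) :=
    tendsto_pow_atTop_nhds_zero_of_lt_one (by norm_num) (by norm_num)
  have t1 : Tendsto (fun n : ℕ => (n : ℝ) * (1 / 2 : ℝ) ^ n) atTop (𝓝 0) :=
    tendsto_self_mul_const_pow_of_lt_one (by norm_num) (by norm_num)
  refine of_tendsto (fun n => (hp n).1) (fun _ => tendsto_const_nhds)
    (fun _ => tendsto_const_nhds) ?_ ?_
  · rw [tendsto_iff_norm_sub_tendsto_zero]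
    exact squeeze_zero (fun _ => norm_nonneg _) (fun n => (hp n).2.1)
      (by simpa using t0.mul_const ‖P‖)
  · rw [tendsto_iff_norm_sub_tendsto_zero]
    have h0 := (t0.mul_const ‖P * Z * P‖).add (t1.mul_const (2 * (‖Z‖ * ‖P‖)))
    simp only [zero_mul, add_zero] at h0
    refine squeeze_zero (fun _ => norm_nonneg _) (fun n => ?_) h0
    rw [sub_neg_eq_add]
    exact (hp n).2.2.trans_eq (by ring)

end Comm

/-- The commutator equation `[f, X] = Y` can be solved at the cost of a weaker weight. -/
theorem exists_comm_eq (hα : (d : ℝ) / 2 < α) {σ' τ γ G : ℝ} {f : ℂ → ℂ} (hσ' : 0 ≤ σ')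
    (hf : IsDistal F ω τ γ f) (hG : 0 ≤ G)
    (hwt : ∀ k : Lattice d, k ≠ 0 → γ⁻¹ * ‖k‖ ^ τ * wt α σ' k ≤ G * wt α σ k)
    (hy : Bd α σ y.coeff b) (hy0 : y 0 = 0) :
    ∃ X : Crossed F ω, Comm f f X y ∧ Bd α σ' X.coeff (G * b) := by
  have hf' : ∀ k : Lattice d, k ≠ 0 → ∃ g : F.Alg,
      (∀ x : ℂ, (f x - f (x - (dot k ω : ℂ))) * ev x g = 1) ∧ ‖g‖ ≤ γ⁻¹ * ‖k‖ ^ τ := hf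
  choose g hg hgn using hf'
  -- At k = 0 the divisor vanishes and so does `y 0`: the diagonal coefficient is free, and 0 is
  -- chosen.
  let c : Lattice d → F.Alg := fun k => if hk : k = 0 then 0 else g k hk * y k
  have hc : Bd α σ' c (G * b) := hy.of_le hα hG fun k => by
    rcases eq_or_ne k 0 with rfl | hk
    · simp only [c, dif_pos, norm_zero, mul_zero]
      exact mul_nonneg hG (mul_nonneg (wt_pos hα _ _).le (norm_nonneg _))
    · have h1 : ‖c k‖ ≤ γ⁻¹ * ‖k‖ ^ τ * ‖y k‖ := by
        simp only [c, dif_neg hk]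
        exact (norm_mul_le _ _).trans (mul_le_mul_of_nonneg_right (hgn k hk) (norm_nonneg _))
      have h2 := mul_le_mul_of_nonneg_left h1 (wt_pos hα σ' k).le
      have h3 := mul_le_mul_of_nonneg_right (hwt k hk) (norm_nonneg (y k))
      exact h2.trans (by linarith)
  refine ⟨mk c (hc.summable_norm hα hσ'), fun k x => ?_, hc⟩
  change _ * ev x (c k) = _
  rcases eq_or_ne k 0 with rfl | hk
  · simp [hy0]
  · simp only [c, dif_neg hk, map_mul]
    rw [← mul_assoc, hg k hk x, one_mul]

end Crossed

/-! ### The KAM iteration -/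

/-- The potential `f - a u`. -/
def potLeft {F : FunctionBanachAlgebra} (f : ℂ → ℂ) (a : ℂ) (u : F.Alg) : ℂ → ℂ :=
  fun x => f x + ev x (-(a • u))

/-- The potential `f + (1 - a) u`. -/
def potRight {F : FunctionBanachAlgebra} (f : ℂ → ℂ) (a : ℂ) (u : F.Alg) : ℂ → ℂ :=
  fun x => f x + ev x ((1 - a) • u)

namespace Crossed

variable {d : ℕ} {F : FunctionBanachAlgebra} {ω : Fin d → ℝ}

theorem smul_diag_mul (c : ℂ) (g : F.Alg) (x : Crossed F ω) :
    diag (c • g) * x = c • (diag g * x) :=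
  ext fun k => by simp [diag_mul_apply]

theorem mul_diag_smul (c : ℂ) (g : F.Alg) (x : Crossed F ω) :
    x * diag (c • g) = c • (x * diag g) :=
  ext fun k => by simp [mul_diag_apply]

theorem mul_smul' (c : ℂ) (x y : Crossed F ω) : x * (c • y) = c • (x * y) := by
  ext k
  rw [smul_apply, mul_apply, mul_apply, ← (summable_conv x y k).tsum_const_smul c]
  exact tsum_congr fun l => by simp

theorem diag_neg (g : F.Alg) : (diag (-g) : Crossed F ω) = -diag g := ext fun k => by
  rcases eq_or_ne k 0 with rfl | hk
  · simp
  · simp [diag_apply_ne _ hk]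

/-- One step of the iteration: the conjugation `Q` which diagonalizes `T` up to the error `E` is
corrected to one that diagonalizes `T + t` up to a smaller error, in a weaker norm. The parameter
`a` distributes the diagonal correction among the two potentials. -/
theorem kam_step {α σ σ' τ γ G q e e₁ : ℝ} (hα : (d : ℝ) / 2 < α) (hσ' : 0 ≤ σ') (hσ : σ' ≤ σ)
    {a : ℂ} (ha : ‖a‖ ≤ 1) {f : ℂ → ℂ} {T t Q P E : Crossed F ω} {u : F.Alg}
    (hPQ : P * Q = 1) (hQP : Q * P = 1)
    (hC : Comm (potLeft f a u) (potRight f a u) Q (Q * E - T * Q))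
    (hQ : Bd α σ (Q - 1).coeff q) (hP : Bd α σ (P - 1).coeff q) (hq : q ≤ 1)
    (hE : Bd α σ E.coeff e) (ht : Bd α σ t.coeff e₁)
    (hD : ∀ v : F.Alg, ‖v - u‖ ≤ e + 4 * e₁ → IsDistal F ω τ γ (potRight f a v))
    (hG : 0 ≤ G)
    (hwt : ∀ k : Lattice d, k ≠ 0 → γ⁻¹ * ‖k‖ ^ τ * wt α σ' k ≤ G * wt α σ k)
    (hx : 4 * G * (e + 4 * e₁) ≤ 1 / 2) :
    ∃ (Q' P' E' : Crossed F ω) (v : F.Alg), P' * Q' = 1 ∧ Q' * P' = 1 ∧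
      Comm (potLeft f a v) (potRight f a v) Q' (Q' * E' - (T + t) * Q') ∧
      Bd α σ' (Q' - Q).coeff (16 * G * (e + 4 * e₁)) ∧
      Bd α σ' (P' - P).coeff (16 * G * (e + 4 * e₁)) ∧
      Bd α σ' E'.coeff ((e + 4 * e₁) * (6 * q + 32 * G * (e + 4 * e₁))) ∧
      ‖v - u‖ ≤ e + 4 * e₁ := by
  have hσ0 : 0 ≤ σ := hσ'.trans hσ
  have hq0 := hQ.1
  have he := hE.1
  have he₁ := ht.1
  set m := e + 4 * e₁ with hm
  have hm0 : 0 ≤ m := by positivity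
  -- the new error before the correction
  obtain ⟨E₁, hE₁⟩ : ∃ z, z = E + P * t * Q := ⟨_, rfl⟩
  have bE₁ : Bd α σ E₁.coeff m := by
    have e1 : E₁ = E + (t + (P - 1) * t + (t * (Q - 1) + (P - 1) * t * (Q - 1))) := by
      rw [hE₁]; noncomm_ring
    have b1 := bd_mul hα hσ0 hP ht
    have b2 := bd_mul hα hσ0 ht hQ
    have b3 := bd_mul hα hσ0 b1 hQ
    rw [e1]
    -- The factor 4 in m = e + 4 e₁ bounds (1 + q)² for q ≤ 1.
    refine (bd_add hα hE (bd_add hα (bd_add hα ht b1) (bd_add hα b2 b3))).mono ?_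
    nlinarith [mul_nonneg hq0 he₁, mul_le_mul_of_nonneg_right hq he₁,
      mul_le_mul_of_nonneg_right hq (mul_nonneg hq0 he₁)]
  obtain ⟨w, hw⟩ : ∃ z, z = E₁ 0 := ⟨_, rfl⟩
  have bD : Bd α σ (diag w : Crossed F ω).coeff m := by rw [hw]; exact bd_diag hα bE₁
  have nw : ‖w‖ ≤ m := by rw [hw]; exact bE₁.norm_apply_le hα hσ0 0
  -- The share a w of the correction acts on the left of Q. Moving it to the right replaces w by P w
  -- Q, and R is the defect, of relative size q since P and Q are close to 1.
  obtain ⟨R, hR⟩ : ∃ z, z = a • (P * diag w * Q - diag w) := ⟨_, rfl⟩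
  have bR : Bd α σ R.coeff (3 * q * m) := by
    have e1 : P * diag w * Q - diag w =
        (P - 1) * diag w + (diag w * (Q - 1) + (P - 1) * diag w * (Q - 1)) := by noncomm_ring
    have b1 := bd_mul hα hσ0 hP bD
    have b2 := bd_mul hα hσ0 bD hQ
    have b3 := bd_mul hα hσ0 b1 hQ
    rw [hR]
    refine bd_smul hα ha ?_
    rw [e1]
    refine (bd_add hα b1 (bd_add hα b2 b3)).mono ?_
    nlinarith [mul_nonneg hq0 hm0, mul_le_mul_of_nonneg_right hq (mul_nonneg hq0 hm0)]
  obtain ⟨E₂, hE₂⟩ : ∃ z, z = E₁ - diag w - R := ⟨_, rfl⟩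
  have bE₂ : Bd α σ E₂.coeff (4 * m) := by
    rw [hE₂]
    refine (bd_sub hα (hw ▸ bd_sub_diag hα bE₁) bR).mono ?_
    nlinarith [mul_le_mul_of_nonneg_right hq hm0]
  -- After the removal of w only the defect R contributes to the diagonal. It is already of second
  -- order, so it stays in the error and no further change of the potentials is needed.
  have hE₂0 : E₂ 0 = -R 0 := by rw [hE₂]; simp [hw]
  obtain ⟨D, hDdef⟩ : ∃ z : Crossed F ω, z = diag (E₂ 0) := ⟨_, rfl⟩
  have bD₂ : Bd α σ D.coeff (3 * q * m) := by
    rw [hDdef, hE₂0, diag_neg]; exact (bd_diag hα bR).neg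
  -- the new potentials
  have hCL : Comm (potLeft f a (u + w)) (potRight f a (u + w)) Q (Q * E₂ - (T + t) * Q) := by
    have h := (hC.add_left (-(a • w))).add_right ((1 - a) • w)
    have eL : (fun x => potLeft f a u x + ev x (-(a • w))) = potLeft f a (u + w) := by
      funext x; simp only [potLeft, smul_add, map_add, map_neg]; ring
    have eR : (fun x => potRight f a u x + ev x ((1 - a) • w)) = potRight f a (u + w) := by
      funext x; simp only [potRight, smul_add, map_add]; ring
    rw [eL, eR] at h
    have hQE : Q * E₁ = Q * E + t * Q := by
      rw [hE₁, mul_add, ← mul_assoc, ← mul_assoc, hQP, one_mul]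
    have hQR : Q * R = a • (diag w * Q) - a • (Q * diag w) := by
      rw [hR, mul_smul', mul_sub, ← mul_assoc, ← mul_assoc, hQP, one_mul, smul_sub]
    have e : Q * E₂ - (T + t) * Q =
        Q * E - T * Q + diag (-(a • w)) * Q - Q * diag ((1 - a) • w) := by
      rw [hE₂, mul_sub, mul_sub, hQE, hQR, diag_neg, neg_mul, smul_diag_mul, mul_diag_smul,
        sub_smul, one_smul, add_mul]
      abel
    rwa [e]
  have hdist := hD (u + w) (by rwa [add_sub_cancel_left])
  -- the commutator equation
  have bY : Bd α σ (-(E₂ - D)).coeff (4 * m) := by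
    rw [hDdef]; exact (bd_sub_diag hα bE₂).neg
  obtain ⟨X, hXC, bX⟩ := exists_comm_eq hα hσ' hdist hG hwt bY (by rw [hDdef]; simp)
  have bX' : Bd α σ' X.coeff (4 * G * m) := bX.mono (by linarith)
  obtain ⟨Y, hXY, hYX, bY'⟩ := exists_inverse_one_add hα hσ' bX' hx
  have hGm : 0 ≤ G * m := mul_nonneg hG hm0
  -- By the Leibniz rule the off-diagonal part of E₂ is cancelled by the commutator of X, leaving Q
  -- (D + E₂ X). Written as Q (1 + X) E', this forces E' = (1 + X)⁻¹ (D + E₂ X), a sum of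
  -- second-order terms.
  refine ⟨Q * (1 + X), (1 + Y) * P, (1 + Y) * (D + E₂ * X), u + w, ?_, ?_, ?_, ?_, ?_, ?_, ?_⟩
  · rw [mul_assoc, ← mul_assoc P, hPQ, one_mul, hYX]
  · rw [mul_assoc, ← mul_assoc _ _ P, hXY, one_mul, hQP]
  · have h := hCL.add (hCL.mul hXC)
    have e1 : Q + Q * X = Q * (1 + X) := by noncomm_ring
    have e2 : Q * (1 + X) * ((1 + Y) * (D + E₂ * X)) = Q * (D + E₂ * X) := by
      rw [mul_assoc, ← mul_assoc (1 + X), hXY, one_mul]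
    rw [e1] at h
    rw [e2]
    convert h using 1
    noncomm_ring
  · have e1 : Q * (1 + X) - Q = X + (Q - 1) * X := by noncomm_ring
    rw [e1]
    refine (bd_add hα bX' (bd_mul hα hσ' (hQ.mono_weight hα hσ) bX')).mono ?_
    nlinarith [mul_le_mul_of_nonneg_right hq hGm]
  · have e1 : (1 + Y) * P - P = Y + Y * (P - 1) := by noncomm_ring
    rw [e1]
    refine (bd_add hα bY' (bd_mul hα hσ' bY' (hP.mono_weight hα hσ))).mono ?_
    nlinarith [mul_le_mul_of_nonneg_right hq hGm]
  · have b1 := bd_add hα (bD₂.mono_weight hα hσ)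
      (bd_mul hα hσ' (bE₂.mono_weight hα hσ) bX')
    have e1 : (1 + Y) * (D + E₂ * X) = (D + E₂ * X) + Y * (D + E₂ * X) := by noncomm_ring
    rw [e1]
    refine (bd_add hα b1 (bd_mul hα hσ' bY' b1)).mono ?_
    have h1 : 0 ≤ 3 * q * m + 4 * m * (4 * G * m) := by positivity
    nlinarith [mul_le_mul_of_nonneg_right (show 2 * (4 * G * m) ≤ 1 by linarith) h1]
  · rwa [add_sub_cancel_left]

end Crossed

/-- Dependent choice, keeping both the invariant of each stage and the link between consecutive
stages. -/
theorem exists_seq_of_step {S : Type*} (I : ℕ → S → Prop) (R : ℕ → S → S → Prop) (s₀ : S)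
    (h0 : I 0 s₀) (h : ∀ n s, I n s → ∃ s', I (n + 1) s' ∧ R n s s') :
    ∃ u : ℕ → S, u 0 = s₀ ∧ ∀ n, I n (u n) ∧ R n (u n) (u (n + 1)) := by
  choose g hg using h
  let v : ∀ n, {s // I n s} := fun n =>
    Nat.rec ⟨s₀, h0⟩ (fun n s => ⟨g n s.1 s.2, (hg n s.1 s.2).1⟩) n
  exact ⟨fun n => (v n).1, rfl, fun n => ⟨(v n).2, (hg n (v n).1 (v n).2).2⟩⟩

theorem sum_range_pow_le {p : ℝ} (hp : 0 ≤ p) (hp1 : p < 1) (n : ℕ) :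
    ∑ j ∈ Finset.range n, p ^ j ≤ 1 / (1 - p) := by
  have := (summable_geometric_of_lt_one hp hp1).sum_le_tsum (Finset.range n) fun _ _ => by positivity
  rwa [tsum_geometric_of_lt_one hp hp1, ← one_div] at this

namespace Crossed

variable {d : ℕ} {F : FunctionBanachAlgebra} {ω : Fin d → ℝ}

/-- The iteration: successive conjugations `Q n` for the truncated operators `T n`. -/
theorem exists_kam_sequence {α τ γ η N r g c Γ : ℝ} (hα : (d : ℝ) / 2 < α) {a : ℂ} (ha : ‖a‖ ≤ 1)
    {f : ℂ → ℂ} {T : ℕ → Crossed F ω} (hT0 : T 0 = 0) (hN : 0 ≤ N) (hr : 0 < r) (hr1 : r < 1)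
    (hg : 0 ≤ g) (hp1 : g * r < 1) (hΓ : 0 ≤ Γ) (hc : 0 ≤ c)
    (hT : ∀ n, Bd α ((1 / 2) ^ n) (T (n + 1) - T n).coeff (c * N * r ^ n))
    (hwt : ∀ n : ℕ, ∀ k : Lattice d, k ≠ 0 →
      γ⁻¹ * ‖k‖ ^ τ * wt α ((1 / 2) ^ (n + 1)) k ≤ Γ * g ^ n * wt α ((1 / 2) ^ n) k)
    (hD : ∀ v : F.Alg, ‖v‖ ≤ η → IsDistal F ω τ γ (potRight f a v))
    (hη : (1 + 4 * c) * N * (1 / (1 - r)) ≤ η)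
    (hsmall : 16 * (Γ * (1 + 4 * c)) * N * (1 / (1 - g * r)) ≤ r / (8 * (1 + 4 * c))) :
    ∃ (Q P E : ℕ → Crossed F ω) (u : ℕ → F.Alg), Q 0 = 1 ∧
      ∀ n, P n * Q n = 1 ∧ Q n * P n = 1 ∧
        Comm (potLeft f a (u n)) (potRight f a (u n)) (Q n) (Q n * E n - T n * Q n) ∧
        Bd α ((1 / 2) ^ n) (E n).coeff (N * r ^ n) ∧
        Bd α ((1 / 2) ^ (n + 1)) (Q (n + 1) - Q n).coeff
          (16 * (Γ * (1 + 4 * c)) * N * (g * r) ^ n) ∧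
        Bd α ((1 / 2) ^ (n + 1)) (P (n + 1) - P n).coeff
          (16 * (Γ * (1 + 4 * c)) * N * (g * r) ^ n) ∧
        ‖u (n + 1) - u n‖ ≤ (1 + 4 * c) * N * r ^ n ∧
        Bd α ((1 / 2) ^ n) (Q n - 1).coeff
          (16 * (Γ * (1 + 4 * c)) * N * (1 / (1 - g * r))) ∧
        Bd α ((1 / 2) ^ n) (P n - 1).coeff
          (16 * (Γ * (1 + 4 * c)) * N * (1 / (1 - g * r))) := by
  set c₁ := 1 + 4 * c with hc₁
  have hc1 : 1 ≤ c₁ := by linarith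
  set L := 16 * (Γ * c₁) * N with hL
  have hp0 : 0 ≤ g * r := by positivity
  set p := g * r with hp
  have hL0 : 0 ≤ L := by positivity
  set q : ℕ → ℝ := fun n => L * ∑ j ∈ Finset.range n, p ^ j with hq
  have hqle : ∀ n, q n ≤ L * (1 / (1 - p)) := fun n =>
    mul_le_mul_of_nonneg_left (sum_range_pow_le hp0 hp1 n) hL0
  have hβ : r / (8 * c₁) ≤ 1 / 8 := by
    rw [div_le_div_iff₀ (by positivity) (by norm_num)]; nlinarith
  have hLβ : L ≤ r / (8 * c₁) := by
    refine le_trans ?_ hsmall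
    refine le_mul_of_one_le_right hL0 ?_
    rw [le_div_iff₀ (by linarith)]; linarith
  -- The state is (Q, P, E, u). The distances of Q and P from 1 are tracked by the partial geometric
  -- sums `q n`, which stay below a fixed threshold.
  let I : ℕ → Crossed F ω × Crossed F ω × Crossed F ω × F.Alg → Prop := fun n s =>
    s.2.1 * s.1 = 1 ∧ s.1 * s.2.1 = 1 ∧
      Comm (potLeft f a s.2.2.2) (potRight f a s.2.2.2) s.1 (s.1 * s.2.2.1 - T n * s.1) ∧
      Bd α ((1 / 2) ^ n) (s.1 - 1).coeff (q n) ∧ Bd α ((1 / 2) ^ n) (s.2.1 - 1).coeff (q n) ∧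
      Bd α ((1 / 2) ^ n) s.2.2.1.coeff (N * r ^ n) ∧
      ‖s.2.2.2‖ ≤ c₁ * N * ∑ j ∈ Finset.range n, r ^ j
  let R : ℕ → Crossed F ω × Crossed F ω × Crossed F ω × F.Alg →
      Crossed F ω × Crossed F ω × Crossed F ω × F.Alg → Prop := fun n s s' =>
    Bd α ((1 / 2) ^ (n + 1)) (s'.1 - s.1).coeff (L * p ^ n) ∧
      Bd α ((1 / 2) ^ (n + 1)) (s'.2.1 - s.2.1).coeff (L * p ^ n) ∧
      ‖s'.2.2.2 - s.2.2.2‖ ≤ c₁ * N * r ^ n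
  have hstep : ∀ n s, I n s → ∃ s', I (n + 1) s' ∧ R n s s' := by
    rintro n ⟨Q, P, E, u⟩ ⟨h1, h2, h3, h4, h5, h6, h7⟩
    dsimp only at h1 h2 h3 h4 h5 h6 h7
    have hσ' : (0 : ℝ) ≤ (1 / 2) ^ (n + 1) := by positivity
    have hσ : (1 / 2 : ℝ) ^ (n + 1) ≤ (1 / 2) ^ n :=
      pow_le_pow_of_le_one (by norm_num) (by norm_num) n.le_succ
    have hrn : 0 ≤ r ^ n := by positivity
    have hm : N * r ^ n + 4 * (c * N * r ^ n) = c₁ * N * r ^ n := by rw [hc₁]; ring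
    have hGm : Γ * g ^ n * (c₁ * N * r ^ n) = L * p ^ n / 16 := by
      rw [hL, hp, mul_pow]; ring
    have hpn : p ^ n ≤ 1 := pow_le_one₀ hp0 hp1.le
    have hLp : L * p ^ n ≤ r / (8 * c₁) := (mul_le_of_le_one_right hL0 hpn).trans hLβ
    have hqβ : q n ≤ r / (8 * c₁) := (hqle n).trans hsmall
    obtain ⟨Q', P', E', v, k1, k2, k3, k4, k5, k6, k7⟩ := kam_step (τ := τ) (γ := γ)
      (G := Γ * g ^ n) hα hσ' hσ ha h1 h2 h3 h4 h5 (by linarith) h6 (hT n)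
      (fun v hv => hD v <| by
        rw [hm] at hv
        have e : ‖v‖ ≤ ‖v - u‖ + ‖u‖ := by simpa using norm_add_le (v - u) u
        refine le_trans ?_ hη
        refine le_trans ?_ (mul_le_mul_of_nonneg_left (sum_range_pow_le hr.le hr1 (n + 1))
          (by positivity))
        rw [Finset.sum_range_succ, mul_add]
        linarith)
      (by positivity) (hwt n) (by rw [hm, mul_assoc, hGm]; linarith)
    rw [hm] at k4 k5 k6 k7
    have e16 : 16 * (Γ * g ^ n) * (c₁ * N * r ^ n) = L * p ^ n := by rw [mul_assoc, hGm]; ring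
    rw [e16] at k4 k5
    have hq' : q (n + 1) = q n + L * p ^ n := by
      simp only [hq]; rw [Finset.sum_range_succ, mul_add]
    refine ⟨(Q', P', E', v), ⟨k1, k2, ?_, ?_, ?_, ?_, ?_⟩, k4, k5, k7⟩
    · simpa using k3
    · have := bd_add hα (h4.mono_weight hα hσ) k4
      rw [hq']
      rwa [show Q - 1 + (Q' - Q) = Q' - 1 by abel] at this
    · have := bd_add hα (h5.mono_weight hα hσ) k5
      rw [hq']
      rwa [show P - 1 + (P' - P) = P' - 1 by abel] at this
    · refine k6.mono ?_
      have e : 32 * (Γ * g ^ n) * (c₁ * N * r ^ n) = 2 * (L * p ^ n) := by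
        rw [mul_assoc, hGm]; ring
      rw [e, pow_succ]
      -- Here the induction closes: eight quantities, each at most r / (8 c₁), turn the error c₁ N
      -- rⁿ into at most N rⁿ⁺¹. The decay is only geometric, matching that of the shells still to
      -- be added.
      have : 6 * q n + 2 * (L * p ^ n) ≤ r / c₁ := by
        have : r / c₁ = 8 * (r / (8 * c₁)) := by field_simp
        linarith
      calc c₁ * N * r ^ n * (6 * q n + 2 * (L * p ^ n)) ≤ c₁ * N * r ^ n * (r / c₁) := by gcongr
        _ = N * (r ^ n * r) := by field_simp
    · dsimp only
      have e : ‖v‖ ≤ ‖v - u‖ + ‖u‖ := by simpa using norm_add_le (v - u) u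
      rw [Finset.sum_range_succ, mul_add]
      linarith
  have hinit : I 0 (1, 1, 0, 0) := by
    refine ⟨one_mul 1, one_mul 1, ?_, ?_, ?_, ?_, ?_⟩
    · have e1 : potLeft f a (0 : F.Alg) = f := by funext x; simp [potLeft]
      have e2 : potRight f a (0 : F.Alg) = f := by funext x; simp [potRight]
      simp only [e1, e2, hT0, mul_zero, zero_mul, sub_zero]
      exact Comm.one
    · simp only [sub_self, q, Finset.range_zero, Finset.sum_empty, mul_zero]
      exact Bd.zero le_rfl
    · simp only [sub_self, q, Finset.range_zero, Finset.sum_empty, mul_zero]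
      exact Bd.zero le_rfl
    · exact Bd.zero (by positivity)
    · simp
  obtain ⟨s, hs0, hs⟩ := exists_seq_of_step I R _ hinit hstep
  refine ⟨fun n => (s n).1, fun n => (s n).2.1, fun n => (s n).2.2.1, fun n => (s n).2.2.2,
    by simp [hs0], fun n => ?_⟩
  obtain ⟨⟨h1, h2, h3, h4, h5, h6, h7⟩, k1, k2, k3⟩ := hs n
  exact ⟨h1, h2, h3, h6, k1, k2, k3, h4.mono (hqle n), h5.mono (hqle n)⟩

theorem exists_limit {E : Type*} [NormedAddCommGroup E] [CompleteSpace E] {u : ℕ → E} {C p : ℝ}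
    (hp1 : p < 1) (hu : ∀ n, ‖u (n + 1) - u n‖ ≤ C * p ^ n) :
    ∃ v, Tendsto u atTop (𝓝 v) :=
  cauchySeq_tendsto_of_complete <| cauchySeq_of_le_geometric p C hp1 fun n => by
    rw [dist_comm, dist_eq_norm]; exact hu n

/-- The limit of the iteration: a conjugation which diagonalizes `T + fL`. -/
theorem exists_kam_limit {α τ γ η N r g c Γ : ℝ} (hα : (d : ℝ) / 2 < α) {a : ℂ} (ha : ‖a‖ ≤ 1)
    {f : ℂ → ℂ} {T : ℕ → Crossed F ω} {T' : Crossed F ω}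
    (hT0 : T 0 = 0) (hN : 0 ≤ N) (hr : 0 < r) (hr1 : r < 1)
    (hg : 0 ≤ g) (hp1 : g * r < 1) (hΓ : 0 ≤ Γ) (hc : 0 ≤ c)
    (hT : ∀ n, Bd α ((1 / 2) ^ n) (T (n + 1) - T n).coeff (c * N * r ^ n))
    (hT' : Tendsto T atTop (𝓝 T'))
    (hwt : ∀ n : ℕ, ∀ k : Lattice d, k ≠ 0 →
      γ⁻¹ * ‖k‖ ^ τ * wt α ((1 / 2) ^ (n + 1)) k ≤ Γ * g ^ n * wt α ((1 / 2) ^ n) k)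
    (hD : ∀ v : F.Alg, ‖v‖ ≤ η → IsDistal F ω τ γ (potRight f a v))
    (hη : (1 + 4 * c) * N * (1 / (1 - r)) ≤ η)
    (hsmall : 16 * (Γ * (1 + 4 * c)) * N * (1 / (1 - g * r)) ≤ r / (8 * (1 + 4 * c))) :
    ∃ (Q P : Crossed F ω) (u : F.Alg), P * Q = 1 ∧ Q * P = 1 ∧
      Comm (potLeft f a u) (potRight f a u) Q (-(T' * Q)) ∧
      Bd α 0 (Q - 1).coeff (16 * (Γ * (1 + 4 * c)) * N * (1 / (1 - g * r))) ∧
      Bd α 0 (P - 1).coeff (16 * (Γ * (1 + 4 * c)) * N * (1 / (1 - g * r))) ∧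
      ∀ (k : Lattice d) (B p : ℝ), 0 ≤ B → p < 1 →
        (∀ n : ℕ, (g * r) ^ n ≤ B * p ^ n * wt α ((1 / 2) ^ (n + 1)) k) →
        ‖(Q - 1) k‖ ≤ 16 * (Γ * (1 + 4 * c)) * N * B / (1 - p) := by
  obtain ⟨Q, P, E, u, hQ0, h⟩ := exists_kam_sequence hα ha hT0 hN hr hr1 hg hp1 hΓ hc hT
    hwt hD hη hsmall
  have hσ : ∀ n : ℕ, (0 : ℝ) ≤ (1 / 2) ^ n := fun n => by positivity
  obtain ⟨Q', hQ'⟩ := exists_limit hp1 fun n =>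
    norm_le_of_bd hα (hσ (n + 1)) (h n).2.2.2.2.1
  obtain ⟨P', hP'⟩ := exists_limit hp1 fun n =>
    norm_le_of_bd hα (hσ (n + 1)) (h n).2.2.2.2.2.1
  obtain ⟨u', hu'⟩ := exists_limit hr1 fun n => (h n).2.2.2.2.2.2.1
  have hE : Tendsto E atTop (𝓝 0) := by
    refine squeeze_zero_norm (fun n => norm_le_of_bd hα (hσ n) (h n).2.2.2.1) ?_
    simpa using (tendsto_pow_atTop_nhds_zero_of_lt_one hr.le hr1).const_mul N
  have hev : ∀ (z : ℂ) (x : ℂ), Tendsto (fun n => ev x (z • u n)) atTop (𝓝 (ev x (z • u'))) :=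
    fun z x => ((evL x).continuous.tendsto _).comp (hu'.const_smul z)
  refine ⟨Q', P', u', ?_, ?_, ?_, ?_, ?_, ?_⟩
  · exact tendsto_nhds_unique (hP'.mul hQ') (by simp [(h _).1])
  · exact tendsto_nhds_unique (hQ'.mul hP') (by simp [(h _).2.1])
  · refine Comm.of_tendsto (fun n => (h n).2.2.1) (fun x => ?_) (fun x => ?_) hQ' ?_
    · simp only [potLeft, map_neg]
      exact (hev a x).neg.const_add _
    · exact (hev (1 - a) x).const_add _
    · simpa using (hQ'.mul hE).sub (hT'.mul hQ')
  · exact bd_of_tendsto (fun n => (h n).2.2.2.2.2.2.2.1.mono_weight hα (hσ n))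
      (hQ'.sub tendsto_const_nhds)
  · exact bd_of_tendsto (fun n => (h n).2.2.2.2.2.2.2.2.mono_weight hα (hσ n))
      (hP'.sub tendsto_const_nhds)
  -- For a fixed k, each increment is measured in the weight of its own stage before summation;
  -- passing first to the limit weight σ = 0 would lose this decay.
  · intro k B p hB hp hk
    have hlim := tendsto_coeff hQ' k
    have := dist_le_of_le_geometric_of_tendsto₀ p (16 * (Γ * (1 + 4 * c)) * N * B) hp
      (fun n => ?_) hlim
    · rw [hQ0, dist_comm, dist_eq_norm] at this
      exact this
    · rw [dist_comm, dist_eq_norm]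
      have h1 := (h n).2.2.2.2.1.wt_mul_norm_le hα k
      have hw := wt_pos hα ((1 / 2) ^ (n + 1)) k
      have h2 := mul_le_mul_of_nonneg_left (hk n)
        (show 0 ≤ 16 * (Γ * (1 + 4 * c)) * N by positivity)
      refine le_of_mul_le_mul_left ?_ hw
      refine h1.trans (h2.trans_eq ?_)
      ring

end Crossed

/-! ### The hopping term as an element of the crossed product -/

section Sobolev

variable {d : ℕ} {φ : Lattice d → ℝ} {α R : ℝ}

theorem sobolevNorm_nonneg (φ : Lattice d → ℝ) (R : ℝ) : 0 ≤ sobolevNorm φ R := Real.sqrt_nonneg _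

theorem sum_sq_le_sobolevNorm_sq
    (hS : Summable fun k : Lattice d => |φ k| ^ 2 * bracket k ^ (2 * R)) (s : Finset (Lattice d)) :
    ∑ k ∈ s, (bracket k ^ R * |φ k|) ^ 2 ≤ sobolevNorm φ R ^ 2 := by
  have h0 : ∀ k : Lattice d, 0 ≤ |φ k| ^ 2 * bracket k ^ (2 * R) := fun k =>
    mul_nonneg (sq_nonneg _) (Real.rpow_nonneg (bracket_pos k).le _)
  rw [sobolevNorm, Real.sq_sqrt (tsum_nonneg h0)]
  refine le_trans (Finset.sum_le_sum fun k _ => ?_) (hS.sum_le_tsum s fun k _ => h0 k)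
  rw [mul_pow, mul_comm 2 R, Real.rpow_mul (bracket_pos k).le, Real.rpow_two, mul_comm]

/-- This guarantees that the `tsum` in `sobolevNorm` is a genuine sum and not the default value 0.
-/
theorem summable_sobolev {s r : ℝ} (hφ : IsPolyHopping φ s) (hr : 2 * r + d < 2 * s) :
    Summable fun k : Lattice d => |φ k| ^ 2 * bracket k ^ (2 * r) := by
  refine (summable_bracket (d := d) (r := 2 * s - 2 * r) (by linarith)).of_nonneg_of_le
    (fun k => mul_nonneg (sq_nonneg _) (Real.rpow_nonneg (bracket_pos k).le _)) fun k => ?_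
  have hb := bracket_pos k
  rcases eq_or_ne k 0 with rfl | hk
  · simp [hφ.1]
  · have h1 := hφ.2 k hk
    rw [← bracket_eq_norm hk] at h1
    calc |φ k| ^ 2 * bracket k ^ (2 * r) ≤ (bracket k ^ (-s)) ^ 2 * bracket k ^ (2 * r) := by
          gcongr
      _ = bracket k ^ (-(2 * s - 2 * r)) := by
          rw [← Real.rpow_two, ← Real.rpow_mul hb.le, ← Real.rpow_add hb]
          congr 1; ring

theorem bd_of_sobolev (hα : (d : ℝ) / 2 < α)
    (hS : Summable fun k : Lattice d => |φ k| ^ 2 * bracket k ^ (2 * R)) {σ G : ℝ} (hG : 0 ≤ G)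
    {E : Type*} [NormedAddCommGroup E] {c : Lattice d → E}
    (hc : ∀ k, wt α σ k * ‖c k‖ ≤ G * (bracket k ^ R * |φ k|)) :
    Bd α σ c (G * sobolevNorm φ R) := by
  refine ⟨mul_nonneg hG (sobolevNorm_nonneg _ _), fun s => ?_⟩
  calc ∑ k ∈ s, (wt α σ k * ‖c k‖) ^ 2 ≤ ∑ k ∈ s, G ^ 2 * (bracket k ^ R * |φ k|) ^ 2 := by
        refine Finset.sum_le_sum fun k _ => ?_
        rw [← mul_pow]
        exact pow_le_pow_left₀ (mul_nonneg (wt_pos hα _ _).le (norm_nonneg _)) (hc k) 2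
    _ ≤ _ := by
        rw [← Finset.mul_sum, mul_pow]
        exact mul_le_mul_of_nonneg_left (sum_sq_le_sobolevNorm_sq hS s) (sq_nonneg G)

end Sobolev

/-- The inequality t ≤ e^t at t = y / m, raised to the power m. -/
theorem rpow_le_mul_exp {m y : ℝ} (hm : 0 < m) (hy : 0 ≤ y) : y ^ m ≤ m ^ m * Real.exp y := by
  have h1 : y / m ≤ Real.exp (y / m) := by linarith [Real.add_one_le_exp (y / m)]
  have h2 := Real.rpow_le_rpow (by positivity) h1 hm.le
  rw [← Real.exp_mul, div_mul_cancel₀ _ hm.ne', Real.div_rpow hy hm.le,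
    div_le_iff₀ (by positivity)] at h2
  linarith

/-- Powers are dominated by exponentials at the dyadic scales. -/
theorem rpow_le_mul_exp_dyadic {m y : ℝ} (hm : 0 < m) (hy : 0 ≤ y) (n : ℕ) :
    y ^ m ≤ m ^ m * 2 ^ m * ((2 : ℝ) ^ m) ^ n * Real.exp ((1 / 2) ^ (n + 1) * y) := by
  have h := rpow_le_mul_exp hm (show 0 ≤ (1 / 2) ^ (n + 1) * y by positivity)
  rw [Real.mul_rpow (by positivity) hy] at h
  have e : ((1 / 2 : ℝ) ^ (n + 1)) ^ m * ((2 : ℝ) ^ m * ((2 : ℝ) ^ m) ^ n) = 1 := by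
    rw [← pow_succ', ← Real.rpow_natCast _ (n + 1), ← Real.rpow_natCast _ (n + 1),
      ← Real.rpow_mul zero_le_two, mul_comm m, Real.rpow_mul zero_le_two,
      ← Real.mul_rpow (by positivity) (by positivity),
      ← Real.mul_rpow (by positivity) (by positivity)]
    norm_num
  have h2 : 0 ≤ (2 : ℝ) ^ m * ((2 : ℝ) ^ m) ^ n := by positivity
  calc y ^ m = ((1 / 2 : ℝ) ^ (n + 1)) ^ m * ((2 : ℝ) ^ m * ((2 : ℝ) ^ m) ^ n) * y ^ m := by
        rw [e, one_mul]
    _ = (2 : ℝ) ^ m * ((2 : ℝ) ^ m) ^ n * (((1 / 2 : ℝ) ^ (n + 1)) ^ m * y ^ m) := by ring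
    _ ≤ (2 : ℝ) ^ m * ((2 : ℝ) ^ m) ^ n * (m ^ m * Real.exp ((1 / 2) ^ (n + 1) * y)) := by gcongr
    _ = _ := by ring

namespace Crossed

variable {d : ℕ} {F : FunctionBanachAlgebra} {ω : Fin d → ℝ}

/-- The element whose coefficients are the constants `c k`. -/
def sym (c : Lattice d → ℝ) (hc : Summable fun k => |c k|) : Crossed F ω :=
  mk (fun k => algebraMap ℂ F.Alg (c k)) (by simpa using hc)

theorem sym_apply (c : Lattice d → ℝ) (hc : Summable fun k => |c k|) (k : Lattice d) :
    (sym c hc : Crossed F ω) k = algebraMap ℂ F.Alg (c k) := rfl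

theorem norm_sym_apply (c : Lattice d → ℝ) (hc : Summable fun k => |c k|) (k : Lattice d) :
    ‖(sym c hc : Crossed F ω) k‖ = |c k| := by simp [sym_apply]

/-- The restriction of a symbol to `⟨k⟩ < 2^n`. -/
def cutoff (φ : Lattice d → ℝ) (n : ℕ) (k : Lattice d) : ℝ := if bracket k < 2 ^ n then φ k else 0

theorem abs_cutoff_le (φ : Lattice d → ℝ) (n : ℕ) (k : Lattice d) : |cutoff φ n k| ≤ |φ k| := by
  unfold cutoff; split_ifs <;> simp

theorem summable_cutoff {φ : Lattice d → ℝ} (hφ : Summable fun k => |φ k|) (n : ℕ) :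
    Summable fun k => |cutoff φ n k| :=
  hφ.of_nonneg_of_le (fun _ => abs_nonneg _) (abs_cutoff_le φ n)

variable {φ : Lattice d → ℝ} {α R : ℝ} (hα : (d : ℝ) / 2 < α)
  (hS : Summable fun k : Lattice d => |φ k| ^ 2 * bracket k ^ (2 * R)) (hφ : Summable fun k => |φ k|)
include hα hS

theorem bd_sym (hR : α ≤ R) :
    Bd α 0 (sym φ hφ : Crossed F ω).coeff (wtConst d α * sobolevNorm φ R) := by
  have hK := one_le_wtConst hα
  refine bd_of_sobolev hα hS (by positivity) fun k => ?_
  have hb := bracket_pos k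
  rw [norm_sym_apply]
  unfold wt
  rw [zero_mul, Real.exp_zero, mul_one, mul_assoc]
  have := one_le_bracket k
  gcongr

omit hS in
/-- The estimate of the high frequencies. -/
theorem wt_mul_le_of_pow_le (hR : α ≤ R) (n : ℕ) {k : Lattice d} (hk : (2 : ℝ) ^ n ≤ bracket k)
    (x : ℝ) (hx : 0 ≤ x) :
    wtConst d α * bracket k ^ α * x ≤
      wtConst d α * ((2 : ℝ) ^ (-(R - α))) ^ n * (bracket k ^ R * x) := by
  have hK := one_le_wtConst hα
  have hb := bracket_pos k
  have e1 : bracket k ^ α = bracket k ^ (-(R - α)) * bracket k ^ R := by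
    rw [← Real.rpow_add hb]; congr 1; ring
  have e2 : bracket k ^ (-(R - α)) ≤ ((2 : ℝ) ^ (-(R - α))) ^ n := by
    rw [← Real.rpow_natCast, ← Real.rpow_mul zero_le_two, mul_comm, Real.rpow_mul zero_le_two,
      Real.rpow_natCast]
    exact Real.rpow_le_rpow_of_nonpos (by positivity) hk (by linarith)
  rw [e1]
  calc wtConst d α * (bracket k ^ (-(R - α)) * bracket k ^ R) * x
      = wtConst d α * bracket k ^ (-(R - α)) * (bracket k ^ R * x) := by ring
    _ ≤ _ := by gcongr

/-- On the shell 2^n ≤ ⟨k⟩ < 2^{n+1} the exponential weight of rate 2^{-n} is at most e², and the R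
- α spare powers of ⟨k⟩ give the factor 2^{-(R-α)n}. -/
theorem bd_cutoff_succ_sub (hR : α ≤ R) (n : ℕ) :
    Bd α ((1 / 2) ^ n) (sym (cutoff φ (n + 1)) (summable_cutoff hφ _) -
      sym (cutoff φ n) (summable_cutoff hφ _) : Crossed F ω).coeff
      (wtConst d α * Real.exp 2 * sobolevNorm φ R * ((2 : ℝ) ^ (-(R - α))) ^ n) := by
  have hK := one_le_wtConst hα
  have := bd_of_sobolev (σ := (1 / 2) ^ n) (G := wtConst d α * Real.exp 2 *
    ((2 : ℝ) ^ (-(R - α))) ^ n) hα hS (by positivity) (c := (sym (cutoff φ (n + 1))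
    (summable_cutoff hφ _) - sym (cutoff φ n) (summable_cutoff hφ _) : Crossed F ω).coeff)
    fun k => ?_
  · convert this using 1; ring
  · have hb := bracket_pos k
    have e : (sym (cutoff φ (n + 1)) (summable_cutoff hφ _) -
        sym (cutoff φ n) (summable_cutoff hφ _) : Crossed F ω) k =
        algebraMap ℂ F.Alg ((cutoff φ (n + 1) k - cutoff φ n k : ℝ) : ℂ) := by
      rw [sub_apply, sym_apply, sym_apply, ← map_sub, Complex.ofReal_sub]
    rw [e, norm_algebraMap', Complex.norm_real, Real.norm_eq_abs]
    have hpos : 0 ≤ wtConst d α * Real.exp 2 * ((2 : ℝ) ^ (-(R - α))) ^ n *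
        (bracket k ^ R * |φ k|) := by positivity
    by_cases h1 : bracket k < 2 ^ n
    · have h2 : bracket k < 2 ^ (n + 1) := h1.trans_le (pow_le_pow_right₀ one_le_two n.le_succ)
      simpa [cutoff, h1, h2] using hpos
    by_cases h2 : bracket k < 2 ^ (n + 1)
    · simp only [cutoff, h1, h2, if_true, if_false, sub_zero]
      have h3 := wt_mul_le_of_pow_le hα hR n (not_lt.1 h1) |φ k| (abs_nonneg _)
      have h4 : Real.exp ((1 / 2) ^ n * ‖k‖) ≤ Real.exp 2 := by
        refine Real.exp_le_exp.2 ?_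
        calc (1 / 2 : ℝ) ^ n * ‖k‖ ≤ (1 / 2) ^ n * 2 ^ (n + 1) := by
              gcongr; exact (norm_le_bracket k).trans h2.le
          _ = 2 := by rw [pow_succ, ← mul_assoc, ← mul_pow]; norm_num
      unfold wt
      calc wtConst d α * bracket k ^ α * Real.exp ((1 / 2) ^ n * ‖k‖) * |φ k|
          = Real.exp ((1 / 2) ^ n * ‖k‖) * (wtConst d α * bracket k ^ α * |φ k|) := by ring
        _ ≤ Real.exp 2 * (wtConst d α * ((2 : ℝ) ^ (-(R - α))) ^ n * (bracket k ^ R * |φ k|)) := by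
            gcongr
        _ = _ := by ring
    · simpa [cutoff, h1, h2] using hpos

theorem tendsto_cutoff (hR : α < R) :
    Tendsto (fun n => (sym (cutoff φ n) (summable_cutoff hφ _) : Crossed F ω)) atTop
      (𝓝 (sym φ hφ)) := by
  have hK := one_le_wtConst hα
  rw [tendsto_iff_norm_sub_tendsto_zero]
  have hr1 : (2 : ℝ) ^ (-(R - α)) < 1 := Real.rpow_lt_one_of_one_lt_of_neg one_lt_two (by linarith)
  have hlim := (tendsto_pow_atTop_nhds_zero_of_lt_one (by positivity) hr1).const_mul
    (wtConst d α * sobolevNorm φ R)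
  rw [mul_zero] at hlim
  refine squeeze_zero (fun _ => norm_nonneg _) (fun n => ?_) hlim
  refine norm_le_of_bd hα le_rfl ?_
  have := bd_of_sobolev (σ := 0) (G := wtConst d α * ((2 : ℝ) ^ (-(R - α))) ^ n) hα hS
    (by positivity) (c := (sym (cutoff φ n) (summable_cutoff hφ _) - sym φ hφ : Crossed F ω).coeff)
    fun k => ?_
  · convert this using 1; ring
  · have hb := bracket_pos k
    have e : (sym (cutoff φ n) (summable_cutoff hφ _) - sym φ hφ : Crossed F ω) k =
        algebraMap ℂ F.Alg ((cutoff φ n k - φ k : ℝ) : ℂ) := by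
      rw [sub_apply, sym_apply, sym_apply, ← map_sub, Complex.ofReal_sub]
    rw [e, norm_algebraMap', Complex.norm_real, Real.norm_eq_abs]
    by_cases h1 : bracket k < 2 ^ n
    · have : 0 ≤ wtConst d α * ((2 : ℝ) ^ (-(R - α))) ^ n * (bracket k ^ R * |φ k|) := by
        positivity
      simpa [cutoff, h1] using this
    · have h3 := wt_mul_le_of_pow_le hα hR.le n (not_lt.1 h1) |φ k| (abs_nonneg _)
      simpa [cutoff, h1, wt] using h3

end Crossed

/-! ### Convergence of the iteration for the hopping operator -/

theorem potLeft_sub_potRight {F : FunctionBanachAlgebra} (f : ℂ → ℂ) (a : ℂ) (u : F.Alg) (x : ℂ) :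
    potLeft f a u x - potRight f a u x = -ev x u := by
  simp only [potLeft, potRight, map_neg, map_smul, smul_eq_mul]; ring

open Crossed in
/-- Diagonalization of `T_φ + fL` by an element of the crossed product, where `fL = f - a u` and
the diagonal form is `fR = f + (1 - a) u`. -/
theorem exists_conjugation {d : ℕ} {α τ R γ m : ℝ} (hα : (d : ℝ) / 2 < α) (hτ : 0 < τ) (hγ : 0 < γ)
    (hm : 0 < m) (hR : α + τ + m < R) :
    ∃ N₀ K : ℝ, 0 < N₀ ∧ 0 < K ∧ ∀ (φ : Lattice d → ℝ) (hφ : Summable fun k => |φ k|), φ 0 = 0 →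
      (Summable fun k : Lattice d => |φ k| ^ 2 * bracket k ^ (2 * R)) →
      sobolevNorm φ R ≤ N₀ → ∀ (F : FunctionBanachAlgebra) (ω : Fin d → ℝ) (f : ℂ → ℂ) (a : ℂ) (η : ℝ),
      ‖a‖ ≤ 1 → K * sobolevNorm φ R ≤ η →
      (∀ v : F.Alg, ‖v‖ ≤ η → IsDistal F ω τ γ (potRight f a v)) →
      ∃ (Q P : Crossed F ω) (u : F.Alg), P * Q = 1 ∧ Q * P = 1 ∧
        Comm (potLeft f a u) (potRight f a u) Q (-(sym φ hφ * Q)) ∧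
        ‖Q - 1‖ ≤ 1 / 8 ∧ ‖P - 1‖ ≤ 1 / 8 ∧ ‖u‖ ≤ K * sobolevNorm φ R ^ 2 ∧
        ∀ k, ‖(Q - 1) k‖ ≤ bracket k ^ (-(α + m)) := by
  have hKw := one_le_wtConst hα
  have hα0 := alpha_pos hα
  obtain ⟨r, hr⟩ : ∃ r, r = (2 : ℝ) ^ (-(R - α)) := ⟨_, rfl⟩
  have hr0 : 0 < r := hr ▸ by positivity
  have hr1 : r < 1 := hr ▸ Real.rpow_lt_one_of_one_lt_of_neg one_lt_two (by linarith)
  have hgr : (2 : ℝ) ^ τ * r = 2 ^ (τ - (R - α)) := by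
    rw [hr, ← Real.rpow_add two_pos]; rfl
  have hp1 : (2 : ℝ) ^ τ * r < 1 :=
    hgr ▸ Real.rpow_lt_one_of_one_lt_of_neg one_lt_two (by linarith)
  have hp'1 : (2 : ℝ) ^ m * ((2 : ℝ) ^ τ * r) < 1 := by
    rw [hgr, ← Real.rpow_add two_pos]
    exact Real.rpow_lt_one_of_one_lt_of_neg one_lt_two (by linarith)
  obtain ⟨Γ, hΓ⟩ : ∃ x, x = γ⁻¹ * (τ ^ τ * 2 ^ τ) := ⟨_, rfl⟩
  have hΓ0 : 0 < Γ := hΓ ▸ by positivity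
  obtain ⟨c, hc⟩ : ∃ x, x = wtConst d α * Real.exp 2 := ⟨_, rfl⟩
  have hc0 : 0 ≤ c := hc ▸ by positivity
  obtain ⟨c₁, hc₁⟩ : ∃ x, x = 1 + 4 * c := ⟨_, rfl⟩
  have hc10 : 1 ≤ c₁ := by linarith
  obtain ⟨K₁, hK₁⟩ : ∃ x, x = 16 * (Γ * c₁) * (1 / (1 - 2 ^ τ * r)) := ⟨_, rfl⟩
  have h1p : 0 < 1 - 2 ^ τ * r := by linarith
  have hK₁0 : 0 < K₁ := hK₁ ▸ by positivity
  obtain ⟨K₂, hK₂⟩ : ∃ x, x = 16 * (Γ * c₁) * (m ^ m * 2 ^ m) / (1 - 2 ^ m * (2 ^ τ * r)) := ⟨_, rfl⟩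
  have h1p' : 0 < 1 - 2 ^ m * (2 ^ τ * r) := by linarith
  have hK₂0 : 0 < K₂ := hK₂ ▸ by positivity
  obtain ⟨K₃, hK₃⟩ : ∃ x, x = c₁ * (1 / (1 - r)) := ⟨_, rfl⟩
  have h1r : 0 < 1 - r := by linarith
  have hK₃0 : 0 < K₃ := hK₃ ▸ by positivity
  have hβ : r / (8 * c₁) ≤ 1 / 8 := by
    rw [div_le_div_iff₀ (by positivity) (by norm_num)]; nlinarith
  -- The first threshold keeps the iteration contracting; the second makes the constant in the decay
  -- of Q - 1 at most 1. In K, the first summand serves the quadratic bound on u, and K₃ bounds the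
  -- total drift of u during the iteration.
  refine ⟨min (r / (8 * c₁) / K₁) (1 / K₂), 2 * (wtConst d α * K₁) + K₃, by positivity,
    by positivity, ?_⟩
  intro φ hφ hφ0 hS hN F ω f a η ha hη hD
  obtain ⟨N, hNdef⟩ : ∃ x, x = sobolevNorm φ R := ⟨_, rfl⟩
  rw [← hNdef] at hN hη ⊢
  have hN0 : 0 ≤ N := hNdef ▸ sobolevNorm_nonneg _ _
  have hN1 : K₁ * N ≤ r / (8 * c₁) := by
    have := hN.trans (min_le_left _ _)
    rwa [le_div_iff₀ hK₁0, mul_comm] at this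
  have hN2 : K₂ * N ≤ 1 := by
    have := hN.trans (min_le_right _ _)
    rwa [le_div_iff₀ hK₂0, mul_comm] at this
  have eK₁ : 16 * (Γ * (1 + 4 * c)) * N * (1 / (1 - 2 ^ τ * r)) = K₁ * N := by
    rw [hK₁, ← hc₁]; ring
  obtain ⟨Q, P, u, h1, h2, h3, h4, h5, h6⟩ := exists_kam_limit (F := F) (ω := ω) (γ := γ) (τ := τ)
    (η := η) (N := N) (r := r) (g := 2 ^ τ) (c := c) (Γ := Γ) (f := f)
    (T := fun n => sym (cutoff φ n) (summable_cutoff hφ n)) (T' := sym φ hφ) hα ha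
    (ext fun k => by
      -- As ⟨k⟩ ≥ 1, the truncation at n = 0 is empty and the iteration can start from Q = 1 with no
      -- error.
      have : ¬ bracket k < 2 ^ 0 := by simpa using one_le_bracket k
      simp only [sym_apply, cutoff, if_neg this]
      simp)
    hN0 hr0 hr1 (by positivity) hp1 hΓ0.le hc0
    (fun n => by
      rw [hc, hNdef, hr]
      exact bd_cutoff_succ_sub hα hS hφ (by linarith) n)
    (tendsto_cutoff hα hS hφ (by linarith))
    (fun n k _ => by
      have h := rpow_le_mul_exp_dyadic hτ (norm_nonneg k) n
      have hb := bracket_pos k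
      -- Half of the exponential weight is kept for the next stage; the other half absorbs |k|^τ.
      have e : Real.exp ((1 / 2) ^ n * ‖k‖) =
          Real.exp ((1 / 2) ^ (n + 1) * ‖k‖) * Real.exp ((1 / 2) ^ (n + 1) * ‖k‖) := by
        rw [← Real.exp_add]; congr 1; ring
      unfold wt
      rw [e, hΓ]
      calc γ⁻¹ * ‖k‖ ^ τ * (wtConst d α * bracket k ^ α * Real.exp ((1 / 2) ^ (n + 1) * ‖k‖))
          ≤ γ⁻¹ * (τ ^ τ * 2 ^ τ * ((2 : ℝ) ^ τ) ^ n * Real.exp ((1 / 2) ^ (n + 1) * ‖k‖)) *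
            (wtConst d α * bracket k ^ α * Real.exp ((1 / 2) ^ (n + 1) * ‖k‖)) := by gcongr
        _ = _ := by ring)
    hD
    (by
      refine le_trans ?_ hη
      have e : (1 + 4 * c) * N * (1 / (1 - r)) = K₃ * N := by rw [hK₃, ← hc₁]; ring
      rw [e]
      have : 0 ≤ 2 * (wtConst d α * K₁) := by positivity
      nlinarith)
    (by rw [eK₁, ← hc₁]; exact hN1)
  rw [eK₁] at h4 h5
  have hQ1 : ‖Q - 1‖ ≤ K₁ * N := norm_le_of_bd hα le_rfl h4
  have hQ8 : ‖Q - 1‖ ≤ 1 / 8 := hQ1.trans (hN1.trans hβ)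
  refine ⟨Q, P, u, h1, h2, h3, hQ8,
    (norm_le_of_bd hα le_rfl h5).trans (hN1.trans hβ), ?_, fun k => ?_⟩
  -- The diagonal coefficient of the conjugation equation; `φ 0 = 0` permits replacing Q by Q - 1,
  -- which gains a second factor N. As Q_0 is within 1/8 of 1, it can then be removed from the left
  -- side.
  · have e : u * Q 0 = (sym φ hφ * (Q - 1) : Crossed F ω) 0 := by
      refine ext_ev fun x => ?_
      have h := h3 0 x
      rw [dot_zero, Complex.ofReal_zero, sub_zero, potLeft_sub_potRight] at h
      have e2 : (sym φ hφ * (Q - 1) : Crossed F ω) 0 = (sym φ hφ * Q : Crossed F ω) 0 := by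
        rw [mul_sub, mul_one, Crossed.sub_apply, sym_apply, hφ0]; simp
      rw [e2, map_mul]
      rw [neg_apply, map_neg, neg_mul] at h
      exact neg_injective h
    have hT : ‖(sym φ hφ : Crossed F ω)‖ ≤ wtConst d α * N := by
      rw [hNdef]; exact norm_le_of_bd hα le_rfl (bd_sym hα hS hφ (by linarith))
    have e3 : u = u * Q 0 - u * (Q - 1) 0 := by
      rw [Crossed.sub_apply, one_eq, diag_apply_zero]; ring
    have h7 : ‖u * Q 0‖ ≤ wtConst d α * N * (K₁ * N) := by
      rw [e]
      refine (norm_apply_le _ _).trans ((norm_mul_le _ _).trans ?_)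
      gcongr
    have h8 : ‖u * (Q - 1) 0‖ ≤ ‖u‖ * (1 / 8) :=
      (norm_mul_le _ _).trans (mul_le_mul_of_nonneg_left ((norm_apply_le _ _).trans hQ8)
        (norm_nonneg _))
    have h9 : ‖u‖ ≤ ‖u * Q 0‖ + ‖u * (Q - 1) 0‖ := by
      conv_lhs => rw [e3]
      exact norm_sub_le _ _
    have : 0 ≤ K₃ * N ^ 2 := by positivity
    have : 0 ≤ wtConst d α * N * (K₁ * N) := by positivity
    nlinarith
  · rcases eq_or_ne k 0 with rfl | hk
    · rw [bracket_zero, Real.one_rpow]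
      exact (norm_apply_le _ _).trans (hQ8.trans (by norm_num))
    · have hb := bracket_pos k
      -- The exponential decay at rate 2^{-(n+1)} is traded for ⟨k⟩^{-m} at the cost of 2^{mn}; the
      -- series still converges because α + τ + m < R.
      have h := h6 k (m ^ m * 2 ^ m * bracket k ^ (-(α + m))) (2 ^ m * (2 ^ τ * r))
        (by positivity) hp'1 fun n => ?_
      · refine h.trans ?_
        calc 16 * (Γ * (1 + 4 * c)) * N * (m ^ m * 2 ^ m * bracket k ^ (-(α + m))) /
              (1 - 2 ^ m * (2 ^ τ * r)) = K₂ * N * bracket k ^ (-(α + m)) := by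
              rw [hK₂, ← hc₁]; ring
          _ ≤ 1 * bracket k ^ (-(α + m)) := by gcongr
          _ = _ := one_mul _
      · have h := rpow_le_mul_exp_dyadic hm (norm_nonneg k) n
        rw [← bracket_eq_norm hk] at h
        have hw : bracket k ^ α * Real.exp ((1 / 2) ^ (n + 1) * bracket k) ≤
            wt α ((1 / 2) ^ (n + 1)) k := by
          unfold wt
          rw [← bracket_eq_norm hk, mul_assoc]
          exact le_mul_of_one_le_left (by positivity) hKw
        have e1 : 1 = bracket k ^ (-(α + m)) * bracket k ^ α * bracket k ^ m := by
          rw [← Real.rpow_add hb, ← Real.rpow_add hb]; simp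
        calc (2 ^ τ * r) ^ n
            = bracket k ^ (-(α + m)) * bracket k ^ α * bracket k ^ m * (2 ^ τ * r) ^ n := by
              rw [← e1, one_mul]
          _ ≤ bracket k ^ (-(α + m)) * bracket k ^ α * (m ^ m * 2 ^ m * ((2 : ℝ) ^ m) ^ n *
                Real.exp ((1 / 2) ^ (n + 1) * bracket k)) * (2 ^ τ * r) ^ n := by gcongr
          _ = m ^ m * 2 ^ m * bracket k ^ (-(α + m)) * (2 ^ m * (2 ^ τ * r)) ^ n *
                (bracket k ^ α * Real.exp ((1 / 2) ^ (n + 1) * bracket k)) := by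
              rw [mul_pow (2 ^ m : ℝ)]; ring
          _ ≤ _ := by gcongr

/-! ### The representation on `ℓ²` -/

section Representation

variable {d : ℕ}

theorem sum_norm_mul_shift_le {b : Lattice d → ℂ} {B : ℝ} (hB : ∀ i, ‖b i‖ ≤ B)
    (l : Lattice d) (u : Ell2 d) (s : Finset (Lattice d)) :
    ∑ i ∈ s, ‖b i * u (i - l)‖ ^ (2 : ENNReal).toReal ≤ (B * ‖u‖) ^ (2 : ENNReal).toReal := by
  have hB0 : 0 ≤ B := (norm_nonneg _).trans (hB 0)
  have h := lp.sum_rpow_le_norm_rpow (p := 2) (by simp) u (s.map (Equiv.subRight l).toEmbedding)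
  rw [Finset.sum_map] at h
  simp only [ENNReal.toReal_ofNat, Real.rpow_two, Equiv.coe_toEmbedding,
    Equiv.subRight_apply] at h ⊢
  rw [mul_pow]
  refine le_trans ?_ (mul_le_mul_of_nonneg_left h (sq_nonneg B))
  rw [Finset.mul_sum]
  refine Finset.sum_le_sum fun i _ => ?_
  rw [norm_mul, mul_pow]
  have := hB i
  gcongr

/-- The operator `(b S_l u)_i = b_i u_{i-l}` for a bounded sequence `b`. -/
def weightedShift (b : Lattice d → ℂ) (B : ℝ) (hB : ∀ i, ‖b i‖ ≤ B) (l : Lattice d) :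
    Ell2 d →L[ℂ] Ell2 d :=
  LinearMap.mkContinuous
    { toFun := fun u => ⟨fun i => b i * u (i - l), memℓp_gen' (sum_norm_mul_shift_le hB l u)⟩
      map_add' := fun u v => by
        apply Subtype.ext; funext i
        exact mul_add _ _ _
      map_smul' := fun c u => by
        apply Subtype.ext; funext i
        exact mul_left_comm _ _ _ } B fun u =>
    lp.norm_le_of_forall_sum_le (by simp)
      (mul_nonneg ((norm_nonneg _).trans (hB 0)) (norm_nonneg _)) (sum_norm_mul_shift_le hB l u)

@[simp] theorem weightedShift_apply (b : Lattice d → ℂ) (B : ℝ) (hB : ∀ i, ‖b i‖ ≤ B)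
    (l : Lattice d) (u : Ell2 d) (i : Lattice d) :
    weightedShift b B hB l u i = b i * u (i - l) := rfl

theorem norm_weightedShift_le (b : Lattice d → ℂ) (B : ℝ) (hB : ∀ i, ‖b i‖ ≤ B) (l : Lattice d) :
    ‖weightedShift b B hB l‖ ≤ B :=
  LinearMap.mkContinuous_norm_le _ ((norm_nonneg _).trans (hB 0)) _

end Representation

namespace Crossed

variable {d : ℕ} {F : FunctionBanachAlgebra} {ω : Fin d → ℝ}

/-- The summands of the representation. -/
def repTerm (x : Crossed F ω) (l : Lattice d) : Ell2 d →L[ℂ] Ell2 d :=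
  weightedShift (fun i => ev (dot i ω : ℂ) (x l)) ‖x l‖ (fun _ => norm_ev_le _ _) l

theorem norm_repTerm_le (x : Crossed F ω) (l : Lattice d) : ‖x.repTerm l‖ ≤ ‖x l‖ :=
  norm_weightedShift_le _ _ _ _

/-- The operator on `ℓ²` with the matrix `x_{i-j}(i · ω)`. -/
def rep (x : Crossed F ω) : Ell2 d →L[ℂ] Ell2 d := ∑' l, x.repTerm l

theorem norm_rep_le (x : Crossed F ω) : ‖x.rep‖ ≤ ‖x‖ :=
  tsum_of_norm_bounded x.hasSum_norm x.norm_repTerm_le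

theorem hasSum_rep (x : Crossed F ω) (u : Ell2 d) (i : Lattice d) :
    HasSum (fun l => ev (dot i ω : ℂ) (x l) * u (i - l)) (x.rep u i) := by
  have h : HasSum x.repTerm x.rep :=
    (Summable.of_norm_bounded x.summable_norm x.norm_repTerm_le).hasSum
  have h1 : HasSum (fun l => x.repTerm l u) (x.rep u) :=
    h.mapL (ContinuousLinearMap.apply ℂ (Ell2 d) u)
  exact h1.mapL (lp.evalCLM ℂ (fun _ : Lattice d => ℂ) 2 i)

theorem rep_apply (x : Crossed F ω) (u : Ell2 d) (i : Lattice d) :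
    x.rep u i = ∑' l, ev (dot i ω : ℂ) (x l) * u (i - l) := (hasSum_rep x u i).tsum_eq.symm

theorem rep_sub (x y : Crossed F ω) : (x - y).rep = x.rep - y.rep := by
  ext u i
  refine (hasSum_rep (x - y) u i).unique ?_
  have := (hasSum_rep x u i).sub (hasSum_rep y u i)
  refine Eq.subst (motive := fun φ => HasSum φ _) (funext fun l => ?_) this
  rw [sub_apply, map_sub, sub_mul]

@[simp] theorem rep_one : (1 : Crossed F ω).rep = 1 := by
  ext u i
  rw [rep_apply, tsum_eq_single 0]
  · simp [one_eq]
  · intro l hl; simp [one_eq, diag_apply_ne _ hl]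

theorem dot_sub_cast (i l : Lattice d) : (dot i ω : ℂ) - (dot l ω : ℂ) = (dot (i - l) ω : ℂ) := by
  rw [dot_sub]; push_cast; rfl

/-- Evaluation at i·ω turns the translation by l·ω into evaluation at (i - l)·ω, so the twisted
convolution becomes a matrix product; the rest is Fubini. -/
theorem rep_mul (x y : Crossed F ω) (u : Ell2 d) : (x * y).rep u = x.rep (y.rep u) := by
  apply lp.ext
  funext i
  have hsum : Summable (Function.uncurry fun l k =>
      ev (dot i ω : ℂ) (x l) * ev (dot (i - l) ω : ℂ) (y (k - l)) * u (i - k)) := by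
    refine Summable.of_norm_bounded (((Equiv.prodComm _ _).summable_iff.2
      (summable_norm_mul_norm x y)).mul_right ‖u‖) fun p => ?_
    simp only [Function.uncurry, norm_mul, Function.comp, Equiv.prodComm_apply, Prod.fst_swap,
      Prod.snd_swap]
    have h1 := norm_ev_le (dot i ω : ℂ) (x p.1)
    have h2 := norm_ev_le (dot (i - p.1) ω : ℂ) (y (p.2 - p.1))
    have h3 := lp.norm_apply_le_norm (p := 2) two_ne_zero u (i - p.2)
    gcongr
  have e1 : (x * y).rep u i = ∑' k, ∑' l,
      ev (dot i ω : ℂ) (x l) * ev (dot (i - l) ω : ℂ) (y (k - l)) * u (i - k) := by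
    rw [rep_apply]
    refine tsum_congr fun k => ?_
    have h := hasSum_ev_mul x y k (dot i ω : ℂ)
    simp only [dot_sub_cast] at h
    rw [← h.tsum_eq, h.summable.tsum_mul_right]
  have e2 : x.rep (y.rep u) i = ∑' l, ∑' k,
      ev (dot i ω : ℂ) (x l) * ev (dot (i - l) ω : ℂ) (y (k - l)) * u (i - k) := by
    rw [rep_apply]
    refine tsum_congr fun l => ?_
    rw [rep_apply, ← (hasSum_rep y u (i - l)).summable.tsum_mul_left,
      ← (Equiv.subRight l).tsum_eq]
    refine tsum_congr fun k => ?_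
    rw [Equiv.subRight_apply, sub_sub_sub_cancel_right, mul_assoc]
  rw [e1, e2]
  exact hsum.tsum_comm

/-- The commutation relation, applied to a vector. -/
theorem Comm.rep_apply_eq {fL fR : ℂ → ℂ} {Q Y : Crossed F ω} (h : Comm fL fR Q Y) {u v : Ell2 d}
    (hv : ∀ i, v i = fR (dot i ω : ℂ) * u i) (i : Lattice d) :
    fL (dot i ω : ℂ) * Q.rep u i = Q.rep v i + Y.rep u i := by
  have h1 := (hasSum_rep Q u i).mul_left (fL (dot i ω : ℂ))
  have h2 := (hasSum_rep Q v i).add (hasSum_rep Y u i)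
  refine h1.unique (Eq.subst (motive := fun φ => HasSum φ _) (funext fun l => ?_) h2)
  have := h l (dot i ω : ℂ)
  rw [dot_sub_cast] at this
  rw [hv, ← this]
  ring

/-- The commutation relation for the inverse of a diagonalizing element. -/
theorem comm_inverse {f : ℂ → ℂ} {a : ℂ} {u : F.Alg} {Q P T : Crossed F ω}
    (hQP : Q * P = 1) (hC : Comm (potLeft f a u) (potRight f a u) Q (-(T * Q)))
    (hQ : ‖Q - 1‖ ≤ 1 / 2) : Comm (potRight f a u) (potLeft f a u) P (P * T) := by
  have e1 : (fun x => potLeft f a u x + ev x u) = potRight f a u := by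
    funext x; linear_combination potLeft_sub_potRight f a u x
  have e2 : (fun x => potRight f a u x + ev x (-u)) = potLeft f a u := by
    funext x; rw [map_neg]; linear_combination -potLeft_sub_potRight f a u x
  -- The two potentials differ by u, an element of the algebra. Moving u to the left makes them
  -- equal, so that `Comm.inverse` applies to Q = 1 + (Q - 1); afterwards u is moved back.
  have h1 := hC.add_left u
  rw [e1] at h1
  have h2 := ((h1.sub Comm.one).inverse hQ (P := P)
    (by rw [add_sub_cancel, hQP])).add_right (-u)
  rw [e2] at h2
  convert h2 using 1
  have : P * (-(T * Q) + diag u * Q - 0) * P = -(P * T) + P * diag u := by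
    calc P * (-(T * Q) + diag u * Q - 0) * P = -(P * T * (Q * P)) + P * diag u * (Q * P) := by
          noncomm_ring
      _ = _ := by rw [hQP, mul_one, mul_one]
  rw [this, diag_neg]
  noncomm_ring

end Crossed

/-! ### Spectral properties of a diagonalized operator -/

section Spectral

open Crossed

variable {d : ℕ} {F : FunctionBanachAlgebra} {ω : Fin d → ℝ} {φ : Lattice d → ℝ}
  (hφ : Summable fun k => |φ k|)

include hφ in
theorem hasSum_rep_sym (u : Ell2 d) (i : Lattice d) :
    HasSum (fun j => (φ (i - j) : ℂ) * u j) ((sym φ hφ : Crossed F ω).rep u i) := by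
  have h := (Equiv.subLeft i).hasSum_iff.2 (hasSum_rep (sym φ hφ : Crossed F ω) u i)
  refine Eq.subst (motive := fun φ => HasSum φ _) (funext fun j => ?_) h
  simp [sym_apply]

theorem mem_hamiltonian_domain {f : ℂ → ℂ} {u : Ell2 d}
    (h1 : ∀ i, Summable fun j => (φ (i - j) : ℂ) * u j)
    (h2 : Memℓp (fun i => ∑' j, (φ (i - j) : ℂ) * u j) 2)
    (h3 : Memℓp (fun i => f (dot i ω : ℂ) * u i) 2) : u ∈ (hamiltonian φ f ω).domain :=
  Submodule.mem_inf.2 ⟨⟨h1, h2⟩, h3⟩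

theorem hamiltonian_apply {f : ℂ → ℂ} {u : Ell2 d} (h : u ∈ (hamiltonian φ f ω).domain)
    (i : Lattice d) : hamiltonian φ f ω ⟨u, h⟩ i =
      ∑' j, (φ (i - j) : ℂ) * u j + f (dot i ω : ℂ) * u i := rfl

/-- The graph of the Hamiltonian. -/
theorem hamiltonian_graph {f : ℂ → ℂ} (u v : Ell2 d) :
    (∃ h : u ∈ (hamiltonian φ f ω).domain, hamiltonian φ f ω ⟨u, h⟩ = v) ↔
      ∀ i, (sym φ hφ : Crossed F ω).rep u i + f (dot i ω : ℂ) * u i = v i := by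
  have hT := hasSum_rep_sym (F := F) (ω := ω) hφ u
  obtain ⟨w, hw⟩ : ∃ w, w = (sym φ hφ : Crossed F ω).rep u := ⟨_, rfl⟩
  rw [← hw] at hT ⊢
  constructor
  · rintro ⟨h, rfl⟩ i
    rw [hamiltonian_apply, (hT i).tsum_eq]
  · intro h
    have e1 : (fun i => ∑' j, (φ (i - j) : ℂ) * u j) = w := funext fun i => (hT i).tsum_eq
    -- T_φ is bounded, so the pointwise equation itself shows that f u is square summable; no
    -- separate domain condition is needed.
    have e2 : (fun i => f (dot i ω : ℂ) * u i) = v - w :=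
      funext fun i => by rw [eq_sub_of_add_eq' (h i)]; rfl
    have hd : u ∈ (hamiltonian φ f ω).domain :=
      mem_hamiltonian_domain (fun i => (hT i).summable) (e1 ▸ lp.memℓp w) (e2 ▸ lp.memℓp (v - w))
    refine ⟨hd, lp.ext (funext fun i => ?_)⟩
    rw [hamiltonian_apply, (hT i).tsum_eq, h i]

/-- `Q` diagonalizes `T_φ + fL` to `fR`, with inverse `P`. -/
structure Diagonalizes (hφ : Summable fun k => |φ k|) (fL fR : ℂ → ℂ) (Q P : Crossed F ω) : Prop where
  left_inv : P * Q = 1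
  right_inv : Q * P = 1
  comm : Comm fL fR Q (-(sym φ hφ * Q))
  comm_inv : Comm fR fL P (P * sym φ hφ)

namespace Diagonalizes

variable {hφ} {fL fR : ℂ → ℂ} {Q P : Crossed F ω} (D : Diagonalizes hφ fL fR Q P)
include D

theorem rep_left (u : Ell2 d) : P.rep (Q.rep u) = u := by
  rw [← rep_mul, D.left_inv, rep_one]; rfl

theorem rep_right (u : Ell2 d) : Q.rep (P.rep u) = u := by
  rw [← rep_mul, D.right_inv, rep_one]; rfl

theorem graph {u v : Ell2 d} (h : ∀ i, v i = fR (dot i ω : ℂ) * u i) :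
    ∃ hu : Q.rep u ∈ (hamiltonian φ fL ω).domain, hamiltonian φ fL ω ⟨Q.rep u, hu⟩ = Q.rep v := by
  rw [hamiltonian_graph (F := F) hφ]
  intro i
  have e : (-(sym φ hφ * Q)).rep u = -(sym φ hφ : Crossed F ω).rep (Q.rep u) := by
    rw [← zero_sub, rep_sub, _root_.sub_apply, rep_mul]
    have : (0 : Crossed F ω).rep = 0 := by rw [← sub_self (0 : Crossed F ω), rep_sub, sub_self]
    rw [this]; simp
  rw [D.comm.rep_apply_eq h i, e, lp.coeFn_neg, Pi.neg_apply]
  ring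

/-- Together with `graph`, this makes the similarity to multiplication by fR exact on the natural
domains, as a two-sided resolvent requires. -/
theorem inv_graph {u v : Ell2 d} (h : ∃ hu : u ∈ (hamiltonian φ fL ω).domain,
    hamiltonian φ fL ω ⟨u, hu⟩ = v) (i : Lattice d) :
    P.rep v i = fR (dot i ω : ℂ) * P.rep u i := by
  rw [hamiltonian_graph (F := F) hφ] at h
  have := D.comm_inv.rep_apply_eq (u := u) (v := v - (sym φ hφ : Crossed F ω).rep u)
    (fun i => by rw [lp.coeFn_sub, Pi.sub_apply, ← h i]; ring) i
  rw [this, rep_mul, map_sub, lp.coeFn_sub, Pi.sub_apply, sub_add_cancel]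

omit D in
theorem eigen_apply (k i : Lattice d) :
    Q.rep (lp.single 2 k (1 : ℂ)) i = ev (dot i ω : ℂ) (Q (i - k)) := by
  rw [rep_apply, tsum_eq_single (i - k)]
  · rw [lp.single_apply]; simp
  · intro l hl
    rw [lp.single_apply, Pi.single_eq_of_ne, mul_zero]
    rintro rfl
    simp at hl

theorem eigen_ne_zero (k : Lattice d) : Q.rep (lp.single 2 k (1 : ℂ)) ≠ 0 := by
  intro h
  have h1 := D.rep_left (lp.single 2 k (1 : ℂ))
  rw [h, map_zero] at h1
  have h2 := congrArg (fun w : Ell2 d => w k) h1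
  simp at h2

theorem eigen_graph (k : Lattice d) :
    ∃ hu : Q.rep (lp.single 2 k (1 : ℂ)) ∈ (hamiltonian φ fL ω).domain,
      hamiltonian φ fL ω ⟨Q.rep (lp.single 2 k (1 : ℂ)), hu⟩ =
        fR (dot k ω : ℂ) • Q.rep (lp.single 2 k (1 : ℂ)) := by
  rw [← map_smul]
  refine D.graph fun i => ?_
  rw [lp.coeFn_smul, Pi.smul_apply, lp.single_apply, smul_eq_mul]
  rcases eq_or_ne i k with rfl | hik
  · rfl
  · simp [Pi.single_eq_of_ne hik]

theorem isEigenfunction (k : Lattice d) :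
    IsEigenfunction (hamiltonian φ fL ω) (Q.rep (lp.single 2 k (1 : ℂ))) :=
  ⟨D.eigen_ne_zero k, _, D.eigen_graph k⟩

/-- Expanding P w in unit vectors and applying the bounded operator Q expands w = Q P w in the
columns of Q. -/
theorem isCompleteSystem :
    IsCompleteSystem (Set.range fun k => Q.rep (lp.single 2 k (1 : ℂ))) := by
  refine eq_top_iff.2 fun w _ => ?_
  have h := Q.rep.hasSum (lp.hasSum_single (p := 2) ENNReal.ofNat_ne_top (P.rep w))
  rw [D.rep_right] at h
  refine (Submodule.isClosed_topologicalClosure _).mem_of_tendsto h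
    (Eventually.of_forall fun s => Submodule.sum_mem _ fun k _ => ?_)
  refine Submodule.le_topologicalClosure _ ?_
  have e : (lp.single 2 k (P.rep w k) : Ell2 d) = P.rep w k • lp.single 2 k (1 : ℂ) := by
    rw [← lp.single_smul, smul_eq_mul, mul_one]
  rw [e, map_smul]
  exact Submodule.smul_mem _ _ (Submodule.subset_span ⟨k, rfl⟩)

theorem isPowerLawLocalized {ρ : ℝ} (hρ : ∀ k, ‖(Q - 1) k‖ ≤ bracket k ^ (-ρ)) :
    IsPowerLawLocalized (hamiltonian φ fL ω) ρ := by
  refine ⟨?_, fun k => Q.rep (lp.single 2 k (1 : ℂ)), D.isEigenfunction, D.isCompleteSystem,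
    fun i k => ?_⟩
  · refine eq_top_iff.2 (D.isCompleteSystem.ge.trans (Submodule.topologicalClosure_mono
      (Submodule.span_mono ?_)))
    rintro _ ⟨k, rfl⟩
    exact D.isEigenfunction k
  · rw [eigen_apply]
    refine (norm_ev_le _ _).trans ?_
    have h1 : Q (i - k) = (1 : Crossed F ω) (i - k) + (Q - 1) (i - k) := by
      rw [Crossed.sub_apply]; ring
    have h2 : ‖(1 : Crossed F ω) (i - k)‖ ≤ bracket (i - k) ^ (-ρ) := by
      rcases eq_or_ne (i - k) 0 with h | h
      · rw [h, one_eq, diag_apply_zero, norm_one, bracket_zero, Real.one_rpow]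
      · rw [one_eq, diag_apply_ne _ h, norm_zero]
        exact Real.rpow_nonneg (bracket_pos _).le _
    rw [h1]
    refine (norm_add_le _ _).trans ?_
    linarith [hρ (i - k)]

/-- Away from the closure, Q (fR - z)⁻¹ P is a bounded resolvent. At a point of the closure,
eigenvalues arbitrarily close to z are incompatible with the norm of any bounded left inverse of the
operator minus z. Self-adjointness plays no role. -/
theorem opSpectrum_eq :
    opSpectrum (hamiltonian φ fL ω) =
      closure (Set.range fun i : Lattice d => fR (dot i ω : ℂ)) := by
  ext z
  constructor
  · intro hz
    by_contra hcl
    refine hz ?_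
    rw [Metric.mem_closure_iff] at hcl
    push Not at hcl
    obtain ⟨ε, hε, hcl⟩ := hcl
    have hdist : ∀ i : Lattice d, ε ≤ ‖fR (dot i ω : ℂ) - z‖ := fun i => by
      have := hcl _ ⟨i, rfl⟩
      rwa [dist_comm, dist_eq_norm] at this
    have hne : ∀ i : Lattice d, fR (dot i ω : ℂ) - z ≠ 0 := fun i =>
      norm_pos_iff.1 (hε.trans_le (hdist i))
    let M : Ell2 d →L[ℂ] Ell2 d := weightedShift (fun i => (fR (dot i ω : ℂ) - z)⁻¹) ε⁻¹
      (fun i => by rw [norm_inv]; exact inv_anti₀ hε (hdist i)) 0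
    have hM : ∀ (u : Ell2 d) (i : Lattice d), M u i = (fR (dot i ω : ℂ) - z)⁻¹ * u i :=
      fun u i => by simp only [M, weightedShift_apply, sub_zero]
    refine ⟨Q.rep.comp (M.comp P.rep), fun w => ?_, fun u => ?_⟩
    · obtain ⟨h1, h2⟩ := D.graph (u := M (P.rep w)) (v := z • M (P.rep w) + P.rep w) fun i => by
        rw [lp.coeFn_add, Pi.add_apply, lp.coeFn_smul, Pi.smul_apply, smul_eq_mul, hM]
        have := hne i
        field_simp
        ring
      refine ⟨h1, ?_⟩
      change hamiltonian φ fL ω ⟨Q.rep (M (P.rep w)), h1⟩ - z • Q.rep (M (P.rep w)) = w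
      rw [h2, map_add, map_smul, D.rep_right, add_sub_cancel_left]
    · have h1 := D.inv_graph (u := u) ⟨u.2, rfl⟩
      have h2 : M (P.rep (hamiltonian φ fL ω u - z • (u : Ell2 d))) = P.rep u := by
        apply lp.ext
        funext i
        rw [hM, map_sub, map_smul, lp.coeFn_sub, Pi.sub_apply, lp.coeFn_smul, Pi.smul_apply,
          smul_eq_mul, h1 i, ← sub_mul, inv_mul_cancel_left₀ (hne i)]
      change Q.rep (M (P.rep (hamiltonian φ fL ω u - z • (u : Ell2 d)))) = u
      rw [h2, D.rep_right]
  · rintro hz ⟨R, -, hR⟩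
    obtain ⟨_, ⟨k, rfl⟩, hk⟩ := Metric.mem_closure_iff.1 hz (‖R‖ + 1)⁻¹ (by positivity)
    obtain ⟨h1, h2⟩ := D.eigen_graph k
    have h3 := hR ⟨_, h1⟩
    rw [h2] at h3
    change R (_ - z • Q.rep (lp.single 2 k (1 : ℂ))) = Q.rep (lp.single 2 k (1 : ℂ)) at h3
    rw [← sub_smul, map_smul] at h3
    have hpos := norm_pos_iff.2 (D.eigen_ne_zero k)
    have h4 : ‖Q.rep (lp.single 2 k (1 : ℂ))‖ ≤ ‖fR (dot k ω : ℂ) - z‖ *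
        (‖R‖ * ‖Q.rep (lp.single 2 k (1 : ℂ))‖) := by
      conv_lhs => rw [← h3, norm_smul]
      exact mul_le_mul_of_nonneg_left (R.le_opNorm _) (norm_nonneg _)
    rw [dist_comm, dist_eq_norm] at hk
    have h5 : ‖fR (dot k ω : ℂ) - z‖ * (‖R‖ + 1) < 1 := by
      rwa [inv_eq_one_div, lt_div_iff₀ (by positivity)] at hk
    nlinarith [norm_nonneg (fR (dot k ω : ℂ) - z), norm_nonneg R]

/-- The eigenvalues are real if the potential is. -/
theorem eigenvalue_real (hQ : ‖Q - 1‖ ≤ 1 / 8) (hP : ‖P - 1‖ ≤ 1 / 8)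
    (hf : ∀ i : Lattice d, (fL (dot i ω : ℂ)).im = 0) (k : Lattice d) :
    (fR (dot k ω : ℂ)).im = 0 := by
  set e : Ell2 d := lp.single 2 k (1 : ℂ) with he
  have hne : ‖e‖ = 1 := by rw [he, lp.norm_single (by norm_num)]; simp
  have hse : star e = e := by
    apply lp.ext; funext i
    rw [lp.star_apply, he, lp.single_apply]
    rcases eq_or_ne i k with rfl | h
    · simp
    · simp [Pi.single_eq_of_ne h]
  have hg := D.eigen_graph k
  rw [← he, hamiltonian_graph (F := F) hφ] at hg
  -- φ and the potential on the orbit are real, so the conjugate of the eigenvector is an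
  -- eigenvector with the conjugate eigenvalue. Transforming it by P and reading off coordinate k
  -- identifies that eigenvalue with fR(k·ω), provided the coordinate is not zero.
  have hg' : ∃ hu : star (Q.rep e) ∈ (hamiltonian φ fL ω).domain,
      hamiltonian φ fL ω ⟨star (Q.rep e), hu⟩ =
        star (fR (dot k ω : ℂ)) • star (Q.rep e) := by
    rw [hamiltonian_graph (F := F) hφ]
    intro i
    have h1 : (sym φ hφ : Crossed F ω).rep (star (Q.rep e)) i =
        star ((sym φ hφ : Crossed F ω).rep (Q.rep e) i) := by
      refine (hasSum_rep_sym (F := F) (ω := ω) hφ (star (Q.rep e)) i).unique ?_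
      have := (hasSum_rep_sym (F := F) (ω := ω) hφ (Q.rep e) i).star
      refine Eq.subst (motive := fun φ => HasSum φ _) (funext fun j => ?_) this
      simp [lp.star_apply]
    have h2 : star (fL (dot i ω : ℂ)) = fL (dot i ω : ℂ) := Complex.conj_eq_iff_im.2 (hf i)
    have h3 := congrArg star (hg i)
    rw [star_add, star_mul', h2] at h3
    rw [h1, lp.star_apply, h3, lp.coeFn_smul, lp.coeFn_smul, Pi.smul_apply, Pi.smul_apply,
      lp.star_apply, smul_eq_mul, smul_eq_mul, star_mul']
  have h := D.inv_graph hg' k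
  rw [map_smul, lp.coeFn_smul, Pi.smul_apply, smul_eq_mul] at h
  -- The transformed vector is within 9/64 + 1/8 < 1 of the real unit vector e.
  have hne0 : P.rep (star (Q.rep e)) k ≠ 0 := by
    have b1 : ‖Q.rep e - e‖ ≤ 1 / 8 := by
      have : Q.rep e - e = (Q - 1).rep e := by rw [rep_sub, rep_one]; rfl
      rw [this]
      refine ((Q - 1).rep.le_opNorm e).trans ?_
      rw [hne, mul_one]
      exact (norm_rep_le _).trans hQ
    have b2 : ‖star (Q.rep e) - e‖ ≤ 1 / 8 := by
      have : star (Q.rep e) - e = star (Q.rep e - e) := by rw [star_sub, hse]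
      rw [this, norm_star]; exact b1
    have b3 : ‖star (Q.rep e)‖ ≤ 9 / 8 := by
      have := norm_add_le (star (Q.rep e) - e) e
      rw [sub_add_cancel, hne] at this
      linarith
    have b4 : ‖P.rep (star (Q.rep e)) - star (Q.rep e)‖ ≤ 9 / 64 := by
      have : P.rep (star (Q.rep e)) - star (Q.rep e) = (P - 1).rep (star (Q.rep e)) := by
        rw [rep_sub, rep_one]; rfl
      rw [this]
      refine ((P - 1).rep.le_opNorm _).trans ?_
      have := (norm_rep_le (P - 1)).trans hP
      calc _ ≤ 1 / 8 * (9 / 8 : ℝ) := by gcongr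
        _ = _ := by norm_num
    have b5 : ‖P.rep (star (Q.rep e)) - e‖ ≤ 9 / 64 + 1 / 8 := by
      have := norm_add_le (P.rep (star (Q.rep e)) - star (Q.rep e)) (star (Q.rep e) - e)
      rw [sub_add_sub_cancel] at this
      linarith
    intro h0
    have b6 := lp.norm_apply_le_norm (p := 2) two_ne_zero (P.rep (star (Q.rep e)) - e) k
    rw [lp.coeFn_sub, Pi.sub_apply, h0, he, lp.single_apply_self] at b6
    norm_num at b6 b5
    linarith
  exact Complex.conj_eq_iff_im.1 (mul_right_cancel₀ hne0 h)

end Diagonalizes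

end Spectral

/-! ### Size of the correction and conclusion -/

theorem distLE_of_norm_le {F : FunctionBanachAlgebra} {g f : ℂ → ℂ} {r : ℝ} {h : F.Alg}
    (hg : ∀ x, g x = f x + ev x h) (hr : ‖h‖ ≤ r) : F.DistLE g f r :=
  ⟨h, funext fun x => by rw [Pi.sub_apply, hg, add_sub_cancel_left]; rfl, hr⟩

/-- A quadratic bound on the correction implies both required bounds for small `N`. -/
theorem smallCorrection_of_norm_le {F : FunctionBanachAlgebra} {f f' : ℂ → ℂ} {h : F.Alg}
    {K N q : ℝ} (hK : 0 < K) (hN : 0 ≤ N) (hf : ∀ x, f' x = f x + ev x h) (hh : ‖h‖ ≤ K * N ^ 2)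
    (h1 : N ≤ 1 / K) (h2 : N ≤ (1 / K) ^ (2 - 1 / q)⁻¹) : SmallCorrection F f' f 1 N q := by
  refine ⟨distLE_of_norm_le hf (hh.trans ?_), fun hq => distLE_of_norm_le hf (hh.trans ?_)⟩
  · rw [le_div_iff₀ hK] at h1
    nlinarith
  · have hq0 : 0 < q := by linarith
    -- This is where q > 1/2 enters: K N^{2 - 1/q} ≤ 1 for small N only if the exponent is positive.
    have hq1 : 1 / q < 2 := by rw [div_lt_iff₀ hq0]; linarith
    rcases hN.eq_or_lt with rfl | hN
    · rw [Real.zero_rpow (by positivity)]; simp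
    · have h3 := Real.rpow_le_rpow hN.le h2 (by linarith : 0 ≤ 2 - 1 / q)
      rw [← Real.rpow_mul (by positivity), inv_mul_cancel₀ (by linarith), Real.rpow_one,
        le_div_iff₀ hK] at h3
      have e : N ^ 2 = N ^ (1 / q) * N ^ (2 - 1 / q) := by
        rw [← Real.rpow_add hN, add_sub_cancel, Real.rpow_two]
      rw [e, one_mul]
      have := Real.rpow_nonneg hN.le (1 / q)
      nlinarith

theorem IsPolyHopping.summable {d : ℕ} {φ : Lattice d → ℝ} {s : ℝ} (hφ : IsPolyHopping φ s)
    (hs : (d : ℝ) < s) : Summable fun k => |φ k| := by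
  refine (summable_bracket hs).of_nonneg_of_le (fun _ => abs_nonneg _) fun k => ?_
  rcases eq_or_ne k 0 with rfl | hk
  · simp [hφ.1]
  · rw [bracket_eq_norm hk]; exact hφ.2 k hk

end PowerLaw

end

theorem mainTheorem6 (d : ℕ) (α₀ τ δ s : ℝ) (hα₀ : (d : ℝ) / 2 < α₀) (hτ : 0 < τ) (hδ : 0 < δ)
    (hs : α₀ + τ + (d : ℝ) / 2 + 12 * δ < s) :
    ∃ C : ℝ, 0 < C ∧ ∀ γ : ℝ, 0 < γ →
      -- inverse problem
      (∃ ε₀ : ℝ, 0 < ε₀ ∧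
        ∀ φ : PowerLaw.Lattice d → ℝ, PowerLaw.IsPolyHopping φ s →
          PowerLaw.sobolevNorm φ (s - (d : ℝ) / 2 - δ) ≤ ε₀ →
        ∀ (F : PowerLaw.FunctionBanachAlgebra) (ω : Fin d → ℝ) (f : ℂ → ℂ),
          PowerLaw.IsDistal F ω τ γ f →
        ∃ f' : ℂ → ℂ,
          PowerLaw.SmallCorrection F f' f C (PowerLaw.sobolevNorm φ (s - (d : ℝ) / 2 - δ))
            (s - (d : ℝ) / 2 - 5 * δ - α₀) ∧
          PowerLaw.IsPowerLawLocalized (PowerLaw.hamiltonian φ f' ω)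
            (s - τ - (d : ℝ) / 2 - 12 * δ) ∧
          ((∀ x : ℂ, (f x).im = 0) →
            PowerLaw.opSpectrum (PowerLaw.hamiltonian φ f' ω) =
              closure (Set.range fun i : PowerLaw.Lattice d => f (PowerLaw.dot i ω : ℂ)))) ∧
      -- direct problem
      (∀ η : ℝ, 0 < η → ∃ ε₀ : ℝ, 0 < ε₀ ∧
        ∀ φ : PowerLaw.Lattice d → ℝ, PowerLaw.IsPolyHopping φ s →
          PowerLaw.sobolevNorm φ (s - (d : ℝ) / 2 - δ) ≤ ε₀ →
        ∀ (F : PowerLaw.FunctionBanachAlgebra) (ω : Fin d → ℝ) (f : ℂ → ℂ),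
          (∀ g : ℂ → ℂ, F.DistLE g f η → PowerLaw.IsDistal F ω τ γ g) →
        ∃ f' : ℂ → ℂ,
          PowerLaw.SmallCorrection F f' f C (PowerLaw.sobolevNorm φ (s - (d : ℝ) / 2 - δ))
            (s - (d : ℝ) / 2 - 5 * δ - α₀) ∧
          PowerLaw.IsPowerLawLocalized (PowerLaw.hamiltonian φ f ω)
            (s - τ - (d : ℝ) / 2 - 12 * δ) ∧
          ((∀ x : ℂ, (f x).im = 0) →
            (∀ i : PowerLaw.Lattice d, (f' (PowerLaw.dot i ω : ℂ)).im = 0) ∧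
            PowerLaw.opSpectrum (PowerLaw.hamiltonian φ f ω) =
              closure (Set.range fun i : PowerLaw.Lattice d => f' (PowerLaw.dot i ω : ℂ)))) := by
  -- The gain m is chosen so that α₀ + m is the required decay rate; α₀ + τ + m then falls short of
  -- the Sobolev order by 11δ.
  have hR : α₀ + τ + (s - τ - (d : ℝ) / 2 - 12 * δ - α₀) < s - (d : ℝ) / 2 - δ := by linarith
  have hm : 0 < s - τ - (d : ℝ) / 2 - 12 * δ - α₀ := by linarith
  have hρ : α₀ + (s - τ - (d : ℝ) / 2 - 12 * δ - α₀) = s - τ - (d : ℝ) / 2 - 12 * δ := by ring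
  -- C = 1 suffices, because the correction is quadratic in N and its constant is absorbed by ε₀.
  refine ⟨1, one_pos, fun γ hγ => ?_⟩
  obtain ⟨N₀, K, hN₀, hK, H⟩ := PowerLaw.exists_conjugation hα₀ hτ hγ hm hR
  rw [hρ] at H
  refine ⟨⟨min N₀ (min (1 / K) ((1 / K) ^ (2 - 1 / (s - (d : ℝ) / 2 - 5 * δ - α₀))⁻¹)),
    by positivity, fun φ hφ hN F ω f hf => ?_⟩, fun η hη =>
    ⟨min (min N₀ (η / K)) (min (1 / K) ((1 / K) ^ (2 - 1 / (s - (d : ℝ) / 2 - 5 * δ - α₀))⁻¹)),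
    by positivity, fun φ hφ hN F ω f hf => ?_⟩⟩
  · have hφs := hφ.summable (by linarith)
    have hN' := le_min_iff.1 hN
    have hN'' := le_min_iff.1 hN'.2
    -- With a = 1 the diagonal form never moves from f, so the non-resonance of f alone is enough
    -- and any η will do.
    have hpot : ∀ v : F.Alg, PowerLaw.potRight f 1 v = f := fun v => by
      funext x; simp [PowerLaw.potRight]
    obtain ⟨Q, P, u, h1, h2, h3, h4, h5, h6, h7⟩ := H φ hφs hφ.1
      (PowerLaw.summable_sobolev hφ (by linarith)) hN'.1 F ω f 1 _ (by simp) le_rfl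
      fun v _ => by rw [hpot]; exact hf
    have D : PowerLaw.Diagonalizes hφs (PowerLaw.potLeft f 1 u) (PowerLaw.potRight f 1 u) Q P :=
      ⟨h1, h2, h3, PowerLaw.Crossed.comm_inverse h2 h3 (h4.trans (by norm_num))⟩
    refine ⟨PowerLaw.potLeft f 1 u, PowerLaw.smallCorrection_of_norm_le (h := -u) hK
      (PowerLaw.sobolevNorm_nonneg _ _) (fun x => by simp [PowerLaw.potLeft]) (by rwa [norm_neg])
      hN''.1 hN''.2, D.isPowerLawLocalized h7, fun _ => ?_⟩
    rw [D.opSpectrum_eq, hpot]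
  · have hφs := hφ.summable (by linarith)
    have hN' := le_min_iff.1 hN
    have hN0 := le_min_iff.1 hN'.1
    have hN'' := le_min_iff.1 hN'.2
    -- With a = 0 the given potential is untouched and the diagonal form drifts; the threshold η / K
    -- keeps it in the ball where non-resonance is assumed.
    have hpot : ∀ v : F.Alg, PowerLaw.potLeft f 0 v = f := fun v => by
      funext x; simp [PowerLaw.potLeft]
    have hηK : K * PowerLaw.sobolevNorm φ (s - (d : ℝ) / 2 - δ) ≤ η := by
      have := hN0.2
      rwa [le_div_iff₀ hK, mul_comm] at this
    obtain ⟨Q, P, u, h1, h2, h3, h4, h5, h6, h7⟩ := H φ hφs hφ.1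
      (PowerLaw.summable_sobolev hφ (by linarith)) hN0.1 F ω f 0 η (by simp) hηK
      fun v hv => hf _ (PowerLaw.distLE_of_norm_le (h := v)
        (fun x => by simp [PowerLaw.potRight]) hv)
    have D : PowerLaw.Diagonalizes hφs (PowerLaw.potLeft f 0 u) (PowerLaw.potRight f 0 u) Q P :=
      ⟨h1, h2, h3, PowerLaw.Crossed.comm_inverse h2 h3 (h4.trans (by norm_num))⟩
    rw [hpot] at D
    exact ⟨PowerLaw.potRight f 0 u, PowerLaw.smallCorrection_of_norm_le (h := u) hK
      (PowerLaw.sobolevNorm_nonneg _ _) (fun x => by simp [PowerLaw.potRight]) h6 hN''.1 hN''.2,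
      D.isPowerLawLocalized h7,
      fun hfr => ⟨D.eigenvalue_real h4 h5 fun i => hfr _, D.opSpectrum_eq⟩⟩
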